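/- Let $V$ be an $n$-dimensional real vector space with a nondegenerate metric $g$ of signature $(p,q)$, $n=p+q$, and let $\mathcal{C}\ell_{p,q}(\mathbb R)$ be its Clifford algebra, with $v^2=g(v,v)$ for $v\in V$. A $\mathbb Z_2$-grading of it is a vector space decomposition $\mathcal{C}\ell_{p,q}(\mathbb R)=\mathcal{C}\ell_0\oplus\mathcal{C}\ell_1$ with $\mathcal{C}\ell_i\mathcal{C}\ell_j\subseteq\mathcal{C}\ell_{i+j \bmod 2}$. It preserves the multivector structure if the projections $\pi_i$ onto $\mathcal{C}\ell_i$ satisfy $\pi_i(V)\subseteq V$, $i=0,1$ (equivalently, if they preserve every $\Lambda^k(V)$), and it is non-trivial if $\mathcal{C}\ell_1\neq 0$. For every non-trivial $\mathbb Z_2$-grading of $\mathcal{C}\ell_{p,q}(\mathbb R)$ that preserves the multivector structure, $V$ has an orthonormal basis each of whose elements lies in $\mathcal{C}\ell_0$ or in $\mathcal{C}\ell_1$. For any such basis, let $p_0$ (respectively $q_0$) be the number of its elements that lie in $\mathcal{C}\ell_0$ and square to $+1$ (respectively $-1$). Then there is an isomorphism of real algebras $$\mathcal{C}\ell_0\cong\mathcal{M}(k,\mathbb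 R)\otimes_{\mathbb R}\mathcal D,\qquad k\in\mathbb N,\quad k^2\dim_{\mathbb R}\mathcal D=2^{n-1},$$ where $\mathcal D$ is given by the following table, whose rows are indexed by $p_0-q_0 \bmod 4$ and whose columns by $p-q \bmod 8$; here $m\,\mathbb K$ stands for the direct sum of $m$ copies of $\mathbb K$, and $\mathbb H$ is the algebra of quaternions. $$\begin{array}{c|cccccccc} & 0&1&2&3&4&5&6&7\\ \hline 0& 2\mathbb R&\mathbb R&\mathbb C&\mathbb H&2\mathbb H&\mathbb H&\mathbb C&\mathbb R\\ 1& 2\mathbb R&4\mathbb R&2\mathbb R&2\mathbb C&2\mathbb H&4\mathbb H&2\mathbb H&2\mathbb C\\ 2& \mathbb C&\mathbb R&2\mathbb R&\mathbb R&\mathbb C&\mathbb H&2\mathbb H&\mathbb H\\ 3& \mathbb C&2\mathbb C&\mathbb C&2\mathbb C&\mathbb C&2\mathbb C&\mathbb C&2\mathbb C \end{array}$$ In particular, $\mathcal D$ depends on $p_0-q_0$ only modulo $4$. Moreover, if $p-q\equiv1\pmod 4$ and $p_0-q_0\equiv1\pmod 4$, then $\mathcal{C}\ell_0$ is not isomorphic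 to the Clifford algebra of any finite-dimensional real vector space with a nondegenerate metric. This does occur: for $n=3$ there is a non-trivial $\mathbb Z_2$-grading preserving the multivector structure, of the Clifford algebra of a nondegenerate metric, such that $\mathcal{C}\ell_0\cong\mathcal{M}(k,\mathbb R)\otimes_{\mathbb R}(\mathbb R\oplus\mathbb R\oplus\mathbb R\oplus\mathbb R)$ with $4k^2=2^{2}$ and $\mathcal{C}\ell_0$ is not a Clifford algebra. -/

import Mathlib

open scoped TensorProduct

universe w u

/-- A `ℤ₂`-grading `A = A₀ ⊕ A₁` of a real algebra: `A` is the direct sum of the subspaces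
`A₀ = part 0` and `A₁ = part 1`, and `Aᵢ Aⱼ ⊆ Aᵢ₊ⱼ`. -/
structure Z2Grading (A : Type*) [Ring A] [Algebra ℝ A] where
  part : ZMod 2 → Submodule ℝ A
  isCompl : IsCompl (part 0) (part 1)
  mul_mem : ∀ (i j : ZMod 2) (a b : A), a ∈ part i → b ∈ part j → a * b ∈ part (i + j)

namespace Z2Grading

variable {A : Type*} [Ring A] [Algebra ℝ A]

/-- The unit is automatically even. -/
theorem one_mem (G : Z2Grading A) : (1 : A) ∈ G.part 0 := by
  obtain ⟨e, he, o, ho, h⟩ : ∃ e ∈ G.part 0, ∃ o ∈ G.part 1, e + o = (1 : A) :=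
    Submodule.mem_sup.1 (G.isCompl.sup_eq_top ▸ Submodule.mem_top)
  have hoo : o * o ∈ G.part 0 := G.mul_mem 1 1 o o ho ho
  have heo : e * o ∈ G.part 1 := by simpa using G.mul_mem 0 1 e o he ho
  have key : o * o = o - e * o := by
    have : (e + o) * o = o := by rw [h, one_mul]
    rw [add_mul] at this
    exact eq_sub_of_add_eq' this
  have h0 : o * o = 0 :=
    Submodule.disjoint_def.1 G.isCompl.disjoint _ hoo (key ▸ (G.part 1).sub_mem ho heo)
  have hee : e * e ∈ G.part 0 := by simpa using G.mul_mem 0 0 e e he he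
  have key2 : e * o = e - e * e := by
    have : e * (e + o) = e := by rw [h, mul_one]
    rw [mul_add] at this
    exact eq_sub_of_add_eq' this
  have h1 : e * o = 0 :=
    Submodule.disjoint_def.1 G.isCompl.disjoint _ (key2 ▸ (G.part 0).sub_mem he hee) heo
  have ho0 : o = 0 := by
    rw [h0, h1, sub_zero] at key
    exact key.symm
  rw [← h, ho0, add_zero]
  exact he

/-- The even part `A₀`, as a subalgebra of `A`. -/
def evenSubalgebra (G : Z2Grading A) : Subalgebra ℝ A :=
  (G.part 0).toSubalgebra G.one_mem fun a b ha hb => by simpa using G.mul_mem 0 0 a b ha hb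

/-- The projection `π₀` of `A` onto `A₀` along `A₁`. -/
noncomputable def proj₀ (G : Z2Grading A) : A →ₗ[ℝ] A := Submodule.projection _ _ G.isCompl

/-- The projection `π₁` of `A` onto `A₁` along `A₀`. -/
noncomputable def proj₁ (G : Z2Grading A) : A →ₗ[ℝ] A := Submodule.projection _ _ G.isCompl.symm

/-- The grading is non-trivial if `A₁ ≠ 0`. -/
def IsNontrivial (G : Z2Grading A) : Prop := G.part 1 ≠ ⊥

end Z2Grading

section CliffordGradings

variable {V : Type*} [AddCommGroup V] [Module ℝ V] {Q : QuadraticForm ℝ V}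

/-- A `ℤ₂`-grading of a Clifford algebra preserves the multivector structure if
`πᵢ(V) ⊆ V` for `i = 0, 1`, where `V` is identified with the space of `1`-vectors. -/
def Z2Grading.PreservesMultivectors (G : Z2Grading (CliffordAlgebra Q)) : Prop :=
  ∀ v : V, G.proj₀ (CliffordAlgebra.ι Q v) ∈ LinearMap.range (CliffordAlgebra.ι Q) ∧
    G.proj₁ (CliffordAlgebra.ι Q v) ∈ LinearMap.range (CliffordAlgebra.ι Q)

/-- An orthonormal basis of `V` (for the metric with `g(v, v) = Q v`) all of whose elements are
even or odd, i.e. the union of orthonormal bases of `V₀ = V ∩ Cl₀` and `V₁ = V ∩ Cl₁`. -/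
structure Z2Grading.IsAdaptedBasis (G : Z2Grading (CliffordAlgebra Q)) {n : ℕ}
    (b : Module.Basis (Fin n) ℝ V) : Prop where
  norm : ∀ i, Q (b i) = 1 ∨ Q (b i) = -1
  orthogonal : ∀ i j, i ≠ j → QuadraticMap.polar Q (b i) (b j) = 0
  homogeneous : ∀ i, CliffordAlgebra.ι Q (b i) ∈ G.part 0 ∨ CliffordAlgebra.ι Q (b i) ∈ G.part 1

/-- The number of even elements of the basis `b` whose square is `c`. For `c = 1` this is `p₀`,
for `c = -1` it is `q₀`. -/
noncomputable def Z2Grading.evenCount (G : Z2Grading (CliffordAlgebra Q)) {n : ℕ}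
    (b : Module.Basis (Fin n) ℝ V) (c : ℝ) : ℕ :=
  Set.ncard {i : Fin n | CliffordAlgebra.ι Q (b i) ∈ G.part 0 ∧ Q (b i) = c}

end CliffordGradings

/-- `A ≅ M(k, ℝ) ⊗ D` as real algebras, with `k` such that `k² dim D = N`. -/
def IsMatrixTensor (N : ℕ) (A D : Type*) [Ring A] [Algebra ℝ A] [Ring D] [Algebra ℝ D] : Prop :=
  ∃ k : ℕ, k ^ 2 * Module.finrank ℝ D = N ∧
    Nonempty (A ≃ₐ[ℝ] (Matrix (Fin k) (Fin k) ℝ) ⊗[ℝ] D)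

/-- Names for the algebras `D` occurring in the table: a name stands for the direct sum of
as many copies of `ℝ`, `ℂ` or `ℍ` as it has letters. -/
inductive Factor
  | R | RR | RRRR | C | CC | H | HH | HHHH

/-- `A ≅ M(k, ℝ) ⊗ D` with `k² dim D = N`, where `D` is the algebra named by the third argument. -/
def HasFactor (N : ℕ) (A : Type*) [Ring A] [Algebra ℝ A] : Factor → Prop
  | .R => IsMatrixTensor N A ℝ
  | .RR => IsMatrixTensor N A (ℝ × ℝ)
  | .RRRR => IsMatrixTensor N A (ℝ × ℝ × ℝ × ℝ)
  | .C => IsMatrixTensor N A ℂ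
  | .CC => IsMatrixTensor N A (ℂ × ℂ)
  | .H => IsMatrixTensor N A (Quaternion ℝ)
  | .HH => IsMatrixTensor N A (Quaternion ℝ × Quaternion ℝ)
  | .HHHH => IsMatrixTensor N A (Quaternion ℝ × Quaternion ℝ × Quaternion ℝ × Quaternion ℝ)

open Factor in
/-- The table of factors; the row is `p₀ - q₀` modulo `4`, the column is `p - q` modulo `8`. -/
def factorTable : Fin 4 → Fin 8 → Factor :=
  ![![RR, R,    C,  H,  HH, H,    C,  R],
    ![RR, RRRR, RR, CC, HH, HHHH, HH, CC],
    ![C,  R,    RR, R,  C,  H,    HH, H],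
    ![C,  CC,   C,  CC, C,  CC,   C,  CC]]

/-- The factor `D` for a row `p₀ - q₀` and a column `p - q` given as integers. -/
def factorOf (row col : ℤ) : Factor :=
  factorTable (Fin.ofNat 4 (row % 4).toNat) (Fin.ofNat 8 (col % 8).toNat)

/-- The real algebra `A` is isomorphic to no Clifford algebra of a finite-dimensional real vector
space with a nondegenerate quadratic form. -/
def NotClifford (A : Type u) [Ring A] [Algebra ℝ A] : Prop :=
  ∀ (W : Type w) [AddCommGroup W] [Module ℝ W] [FiniteDimensional ℝ W] (Q' : QuadraticForm ℝ W),
    (QuadraticMap.associated Q').Nondegenerate → IsEmpty (A ≃ₐ[ℝ] CliffordAlgebra Q')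

/-! Fix an adapted orthonormal basis `e`, with signs `s i = e i ^ 2`, and one odd element `e o`,
which exists because the grading is non-trivial. The even basis vectors, together with the products
`e o * e j` for the other odd `j`, generate `Cl₀`. Within each family distinct elements anticommute,
the two families commute with each other, and `(e o * e j) ^ 2 = -s o * s j`. Hence `Cl₀` is a
tensor product of two Clifford algebras (`IsCliffordSystem.exists_even_equiv`), a dimension count
showing that there are no further relations. With `r = p₀ - q₀` and `c = p - q`, their sign sums are
`r` and `1 - s o * (c - r)`.

Up to matrix factors, a real Clifford algebra depends only on its sign sum modulo 8
(`isMatrixOverFactor_signForm`). This follows by splitting off two generators at a time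
(`IsCliffordSystem.tensor`), each pair contributing `M(2, ℝ)` or `ℍ`. Tensor products of the factors
`ℝ`, `ℂ`, `ℍ` and their doubles then give the table (`cliffordFactor_mul_cliffordFactor`).

The centre separates the exceptional cases: a nondegenerate Clifford algebra has centre of dimension
at most 2, while `4ℝ` and `4ℍ` have centre of dimension 4. Adapted bases exist because even and odd
vectors are orthogonal, so the form is nondegenerate on each of the two subspaces. -/

/-! ### Matrix algebras over a fixed algebra -/

/-- `A` is isomorphic to a (nonzero) matrix algebra over `D`. -/
def IsMatrixOver (A D : Type*) [Ring A] [Algebra ℝ A] [Ring D] [Algebra ℝ D] : Prop :=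
  ∃ k : ℕ, k ≠ 0 ∧ Nonempty (A ≃ₐ[ℝ] (Matrix (Fin k) (Fin k) ℝ) ⊗[ℝ] D)

namespace IsMatrixOver

variable {A B D E : Type*} [Ring A] [Algebra ℝ A] [Ring B] [Algebra ℝ B]
  [Ring D] [Algebra ℝ D] [Ring E] [Algebra ℝ E]

theorem of_matrix (k : ℕ) (hk : k ≠ 0) (e : A ≃ₐ[ℝ] Matrix (Fin k) (Fin k) ℝ) :
    IsMatrixOver A ℝ :=
  ⟨k, hk, ⟨e.trans (Algebra.TensorProduct.rid ℝ ℝ _).symm⟩⟩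

theorem bijective_algebraMap_matrix :
    Function.Bijective (Algebra.ofId ℝ (Matrix (Fin 1) (Fin 1) ℝ)) :=
  ⟨(algebraMap ℝ (Matrix (Fin 1) (Fin 1) ℝ)).injective, fun M => ⟨M 0 0, by
    ext i j
    simp [Algebra.ofId_apply, Matrix.algebraMap_matrix_apply, Subsingleton.elim i 0,
      Subsingleton.elim j 0]⟩⟩

theorem of_algEquiv (e : A ≃ₐ[ℝ] D) : IsMatrixOver A D :=
  ⟨1, one_ne_zero, ⟨(e.trans (Algebra.TensorProduct.lid ℝ D).symm).trans
    (Algebra.TensorProduct.congr (AlgEquiv.ofBijective _ bijective_algebraMap_matrix) .refl)⟩⟩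

theorem refl : IsMatrixOver A A := of_algEquiv .refl

/-- The tensor product of two matrix algebras is a matrix algebra. -/
noncomputable def tensorMatrixEquiv (k l : ℕ) :
    Matrix (Fin k) (Fin k) ℝ ⊗[ℝ] Matrix (Fin l) (Fin l) ℝ ≃ₐ[ℝ]
      Matrix (Fin (k * l)) (Fin (k * l)) ℝ :=
  (Matrix.kroneckerAlgEquiv (Fin k) (Fin l) ℝ).trans
    (Matrix.reindexAlgEquiv ℝ ℝ finProdFinEquiv)

theorem trans (h : IsMatrixOver A D) (h' : IsMatrixOver D E) : IsMatrixOver A E := by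
  obtain ⟨k, hk, ⟨e⟩⟩ := h
  obtain ⟨l, hl, ⟨f⟩⟩ := h'
  exact ⟨k * l, mul_ne_zero hk hl, ⟨(e.trans (Algebra.TensorProduct.congr .refl f)).trans
    ((Algebra.TensorProduct.assoc ℝ ℝ ℝ _ _ _).symm.trans
      (Algebra.TensorProduct.congr (tensorMatrixEquiv k l) .refl))⟩⟩

theorem tensor (h : IsMatrixOver A D) (h' : IsMatrixOver B E) :
    IsMatrixOver (A ⊗[ℝ] B) (D ⊗[ℝ] E) := by
  obtain ⟨k, hk, ⟨e⟩⟩ := h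
  obtain ⟨l, hl, ⟨f⟩⟩ := h'
  exact ⟨k * l, mul_ne_zero hk hl, ⟨(Algebra.TensorProduct.congr e f).trans
    ((Algebra.TensorProduct.tensorTensorTensorComm ℝ ℝ ℝ ℝ _ _ _ _).trans
      (Algebra.TensorProduct.congr (tensorMatrixEquiv k l) .refl))⟩⟩

theorem prod (h : IsMatrixOver A D) : IsMatrixOver (A × A) (D × D) := by
  obtain ⟨k, hk, ⟨e⟩⟩ := h
  exact ⟨k, hk, ⟨(AlgEquiv.prodCongr e e).trans
    (Algebra.TensorProduct.prodRight ℝ ℝ _ D D).symm⟩⟩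

theorem tensor_comm : IsMatrixOver (A ⊗[ℝ] B) (B ⊗[ℝ] A) :=
  of_algEquiv (Algebra.TensorProduct.comm ℝ A B)

theorem tensor_symm (h : IsMatrixOver (A ⊗[ℝ] B) D) : IsMatrixOver (B ⊗[ℝ] A) D :=
  tensor_comm.trans h

theorem tensor_real : IsMatrixOver (A ⊗[ℝ] ℝ) A :=
  of_algEquiv (Algebra.TensorProduct.rid ℝ ℝ A)

theorem tensor_prod (h : IsMatrixOver (A ⊗[ℝ] B) D) :
    IsMatrixOver (A ⊗[ℝ] (B × B)) (D × D) :=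
  (of_algEquiv (Algebra.TensorProduct.prodRight ℝ ℝ A B B)).trans h.prod

theorem prod_assoc (h : IsMatrixOver A ((D × D) × (D × D))) :
    IsMatrixOver A (D × D × D × D) :=
  h.trans (of_algEquiv (AlgEquiv.ofAlgHom
    (((AlgHom.fst ℝ D D).comp (.fst ℝ (D × D) (D × D))).prod
      (((AlgHom.snd ℝ D D).comp (.fst ℝ (D × D) (D × D))).prod (.snd ℝ (D × D) (D × D))))
    (((AlgHom.fst ℝ D (D × D × D)).prod ((AlgHom.fst ℝ D (D × D)).comp (.snd ℝ D (D × D × D)))).prod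
      ((AlgHom.snd ℝ D (D × D)).comp (.snd ℝ D (D × D × D)))) rfl rfl))

/-- The size `k` need not be tracked: comparing dimensions recovers it. -/
theorem isMatrixTensor (h : IsMatrixOver A D) : IsMatrixTensor (Module.finrank ℝ A) A D := by
  obtain ⟨k, -, ⟨e⟩⟩ := h
  refine ⟨k, ?_, ⟨e⟩⟩
  rw [e.toLinearEquiv.finrank_eq, Module.finrank_tensorProduct, Module.finrank_matrix]
  simp [sq]

end IsMatrixOver

/-- `A` is isomorphic to a matrix algebra over the algebra with the given name. -/
def IsMatrixOverFactor (A : Type*) [Ring A] [Algebra ℝ A] : Factor → Prop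
  | .R => IsMatrixOver A ℝ
  | .RR => IsMatrixOver A (ℝ × ℝ)
  | .RRRR => IsMatrixOver A (ℝ × ℝ × ℝ × ℝ)
  | .C => IsMatrixOver A ℂ
  | .CC => IsMatrixOver A (ℂ × ℂ)
  | .H => IsMatrixOver A (Quaternion ℝ)
  | .HH => IsMatrixOver A (Quaternion ℝ × Quaternion ℝ)
  | .HHHH => IsMatrixOver A (Quaternion ℝ × Quaternion ℝ × Quaternion ℝ × Quaternion ℝ)

namespace IsMatrixOverFactor

variable {A B : Type*} [Ring A] [Algebra ℝ A] [Ring B] [Algebra ℝ B]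

theorem hasFactor {f : Factor} (h : IsMatrixOverFactor A f) :
    HasFactor (Module.finrank ℝ A) A f := by
  cases f <;> exact IsMatrixOver.isMatrixTensor h

theorem of_isMatrixOver {f : Factor} (h : IsMatrixOver A B) (hB : IsMatrixOverFactor B f) :
    IsMatrixOverFactor A f := by
  cases f <;> exact h.trans hB

theorem of_algEquiv {f : Factor} (e : A ≃ₐ[ℝ] B) (hB : IsMatrixOverFactor B f) :
    IsMatrixOverFactor A f :=
  of_isMatrixOver (.of_algEquiv e) hB

theorem tensor_matrix {f : Factor} (hA : IsMatrixOverFactor A f) (hB : IsMatrixOver B ℝ) :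
    IsMatrixOverFactor (A ⊗[ℝ] B) f :=
  of_isMatrixOver ((IsMatrixOver.refl.tensor hB).trans .tensor_real) hA

end IsMatrixOverFactor

/-! ### Generators and relations for Clifford algebras -/

/-- Anticommuting elements of a real algebra `A` with squares `s i = ±1`, generating `A`, and as
independent as possible: `dim A = 2 ^ n` where `n` is the number of generators. -/
structure IsCliffordSystem {ι A : Type*} [Fintype ι] [Ring A] [Algebra ℝ A]
    (s : ι → ℤˣ) (e : ι → A) : Prop where
  sq : ∀ i, e i * e i = algebraMap ℝ A ((s i : ℤ) : ℝ)
  anticomm : ∀ i j, i ≠ j → e i * e j = -(e j * e i)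
  adjoin_eq_top : Algebra.adjoin ℝ (Set.range e) = ⊤
  finrank_eq : Module.finrank ℝ A = 2 ^ Fintype.card ι

section CliffordOfBasis

variable {ι V : Type*} [AddCommGroup V] [Module ℝ V] {Q : QuadraticForm ℝ V}

theorem finrank_cliffordAlgebra [Fintype ι] (Q : QuadraticForm ℝ V) (b : Module.Basis ι ℝ V) :
    Module.finrank ℝ (CliffordAlgebra Q) = 2 ^ Fintype.card ι := by
  rw [(CliffordAlgebra.equivExterior Q).finrank_eq,
    Module.finrank_eq_card_basis (b.reindex (Fintype.equivFin ι)).ExteriorAlgebra]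
  simp

theorem isCliffordSystem_basis [Fintype ι] (b : Module.Basis ι ℝ V) {s : ι → ℤˣ}
    (hs : ∀ i, Q (b i) = ((s i : ℤ) : ℝ))
    (ho : ∀ i j, i ≠ j → QuadraticMap.polar Q (b i) (b j) = 0) :
    IsCliffordSystem s fun i => CliffordAlgebra.ι Q (b i) where
  sq i := by rw [CliffordAlgebra.ι_sq_scalar, hs]
  anticomm i j hij := by
    rw [eq_neg_iff_add_eq_zero, CliffordAlgebra.ι_mul_ι_add_swap, ho i j hij, map_zero]
  adjoin_eq_top := by
    rw [eq_top_iff, ← CliffordAlgebra.adjoin_range_ι, Algebra.adjoin_le_iff]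
    rintro _ ⟨v, rfl⟩
    rw [← b.sum_repr v, map_sum]
    refine Subalgebra.sum_mem _ fun i _ => ?_
    rw [map_smul]
    exact Subalgebra.smul_mem _ (Algebra.subset_adjoin (Set.mem_range_self i)) _
  finrank_eq := finrank_cliffordAlgebra Q b

/-- As 2 is invertible, the relation `v² = Q v` polarises to a bilinear identity, which need only be
checked on pairs of basis vectors. -/
theorem exists_cliffordAlgebra_lift {A : Type*} [Ring A] [Algebra ℝ A]
    (b : Module.Basis ι ℝ V) {s : ι → ℤˣ}
    (hs : ∀ i, Q (b i) = ((s i : ℤ) : ℝ))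
    (ho : ∀ i j, i ≠ j → QuadraticMap.polar Q (b i) (b j) = 0) {e : ι → A}
    (sq : ∀ i, e i * e i = algebraMap ℝ A ((s i : ℤ) : ℝ))
    (anticomm : ∀ i j, i ≠ j → e i * e j = -(e j * e i)) :
    ∃ f : CliffordAlgebra Q →ₐ[ℝ] A, ∀ i, f (CliffordAlgebra.ι Q (b i)) = e i := by
  have key : ∀ v, b.constr ℝ e v * b.constr ℝ e v = algebraMap ℝ A (Q v) := by
    have h2 : IsUnit (2 : A) := by
      rw [← map_ofNat (algebraMap ℝ A) 2]
      exact (IsUnit.mk0 (2 : ℝ) two_ne_zero).map (algebraMap ℝ A)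
    rw [CliffordAlgebra.forall_mul_self_eq_iff h2]
    refine b.ext fun i => b.ext fun j => ?_
    simp only [LinearMap.add_apply, LinearMap.coe_comp, Function.comp_apply,
      LinearMap.compl₂_apply, LinearMap.mul_apply', LinearMap.flip_apply, LinearMap.compr₂_apply,
      QuadraticMap.polarBilin_apply_apply, Algebra.linearMap_apply, Module.Basis.constr_basis]
    rcases eq_or_ne i j with rfl | hij
    · rw [sq, QuadraticMap.polar_self, hs, two_smul, map_add]
    · rw [ho i j hij, anticomm i j hij, map_zero, neg_add_cancel]
  exact ⟨CliffordAlgebra.lift Q ⟨b.constr ℝ e, key⟩, fun i => by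
    rw [CliffordAlgebra.lift_ι_apply, Module.Basis.constr_basis]⟩

end CliffordOfBasis

/-- The quadratic form `∑ ± xᵢ²` with given signs. -/
noncomputable def signForm {ι : Type*} [Fintype ι] (s : ι → ℤˣ) : QuadraticForm ℝ (ι → ℝ) :=
  QuadraticMap.weightedSumSquares ℝ fun i => ((s i : ℤ) : ℝ)

section SignForm

variable {ι : Type*} [Fintype ι] (s : ι → ℤˣ)

theorem signForm_basis [DecidableEq ι] (i : ι) :
    signForm s (Pi.basisFun ℝ ι i) = ((s i : ℤ) : ℝ) := by
  simp [signForm, QuadraticMap.weightedSumSquares_apply, Pi.single_apply]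

theorem polar_signForm_basis [DecidableEq ι] (i j : ι) (hij : i ≠ j) :
    QuadraticMap.polar (signForm s) (Pi.basisFun ℝ ι i) (Pi.basisFun ℝ ι j) = 0 := by
  simp only [QuadraticMap.polar, signForm, QuadraticMap.weightedSumSquares_apply, smul_eq_mul,
    ← Finset.sum_sub_distrib]
  refine Finset.sum_eq_zero fun k _ => ?_
  rcases eq_or_ne k i with rfl | hki
  · simp [hij]
  · simp [Pi.single_apply, hki]

theorem isCliffordSystem_signForm [DecidableEq ι] :
    IsCliffordSystem s fun i => CliffordAlgebra.ι (signForm s) (Pi.basisFun ℝ ι i) :=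
  isCliffordSystem_basis _ (signForm_basis s) (polar_signForm_basis s)

end SignForm

theorem AlgHom.surjective_of_adjoin {A B : Type*} [Ring A] [Algebra ℝ A] [Ring B] [Algebra ℝ B]
    (f : A →ₐ[ℝ] B) {t : Set B} (ht : Algebra.adjoin ℝ t = ⊤) (h : t ⊆ f.range) :
    Function.Surjective f := by
  rw [← AlgHom.range_eq_top, eq_top_iff, ← ht]
  exact Algebra.adjoin_le h

namespace IsCliffordSystem

variable {ι κ A B M : Type*} [Fintype ι] [Fintype κ] [Ring A] [Algebra ℝ A] [Ring B] [Algebra ℝ B]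
  [Ring M] [Algebra ℝ M] {s : ι → ℤˣ} {e : ι → A}

theorem finite (h : IsCliffordSystem s e) : Module.Finite ℝ A :=
  Module.finite_of_finrank_pos (by rw [h.finrank_eq]; positivity)

/-- The universal property gives a map that hits the generators, and a surjection between spaces of
the same dimension `2 ^ n` is bijective. So the signs alone determine the algebra. -/
theorem nonempty_algEquiv_signForm (h : IsCliffordSystem s e) :
    Nonempty (CliffordAlgebra (signForm s) ≃ₐ[ℝ] A) := by
  classical
  have h' := isCliffordSystem_signForm s
  obtain ⟨f, hf⟩ := exists_cliffordAlgebra_lift _ (signForm_basis s) (polar_signForm_basis s)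
    h.sq h.anticomm
  have hsurj : Function.Surjective f := by
    refine f.surjective_of_adjoin h.adjoin_eq_top ?_
    rintro _ ⟨i, rfl⟩
    exact ⟨_, hf i⟩
  have := h.finite
  have := h'.finite
  refine ⟨AlgEquiv.ofBijective f ⟨?_, hsurj⟩⟩
  exact (LinearMap.injective_iff_surjective_of_finrank_eq_finrank (f := f.toLinearMap)
    (h'.finrank_eq.trans h.finrank_eq.symm)).2 hsurj

theorem nonempty_algEquiv (h : IsCliffordSystem s e) {e' : ι → B} (h' : IsCliffordSystem s e') :
    Nonempty (A ≃ₐ[ℝ] B) :=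
  let ⟨f⟩ := h.nonempty_algEquiv_signForm
  let ⟨g⟩ := h'.nonempty_algEquiv_signForm
  ⟨f.symm.trans g⟩

theorem reindex (h : IsCliffordSystem s e) (σ : κ ≃ ι) : IsCliffordSystem (s ∘ σ) (e ∘ σ) where
  sq i := h.sq (σ i)
  anticomm i j hij := h.anticomm _ _ (σ.injective.ne hij)
  adjoin_eq_top := by rw [σ.surjective.range_comp, h.adjoin_eq_top]
  finrank_eq := by rw [h.finrank_eq, Fintype.card_congr σ]

/-- The product `ω = m 0 * m 1` anticommutes with both `m j` and has square `-(a * b)`. Twisting `e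
i` by `ω` makes it anticommute with `1 ⊗ m j` and multiplies its square by `-(a * b)`, which cancels
the sign put into `hB`. -/
theorem tensor {a b : ℤˣ} {s : κ → ℤˣ} {e : κ → B} {m : Fin 2 → M}
    (hB : IsCliffordSystem (fun i => -(a * b) * s i) e) (hM : IsCliffordSystem ![a, b] m) :
    IsCliffordSystem (Sum.elim s ![a, b])
      (Sum.elim (fun i => e i ⊗ₜ[ℝ] (m 0 * m 1)) fun j => 1 ⊗ₜ[ℝ] m j) := by
  have h0 := hM.sq 0
  have h1 := hM.sq 1
  have h01 := hM.anticomm 0 1 (by simp)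
  have h10 := hM.anticomm 1 0 (by simp)
  simp only [Matrix.cons_val_zero, Matrix.cons_val_one] at h0 h1
  have hab : (((a * b : ℤˣ) : ℤ) : ℝ) * (((a * b : ℤˣ) : ℤ) : ℝ) = 1 := by
    rw [← Int.cast_mul, ← Units.val_mul, Int.units_mul_self]; simp
  have hω : (m 0 * m 1) * (m 0 * m 1) = algebraMap ℝ M (-(((a * b : ℤˣ) : ℤ) : ℝ)) := by
    calc (m 0 * m 1) * (m 0 * m 1) = m 0 * (m 1 * m 0) * m 1 := by noncomm_ring
      _ = -((m 0 * m 0) * (m 1 * m 1)) := by rw [h10]; noncomm_ring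
      _ = _ := by rw [h0, h1, ← map_mul, ← map_neg]; simp
  have hωm : ∀ j, m 0 * m 1 * m j = -(m j * (m 0 * m 1)) := by
    intro j
    fin_cases j
    · change m 0 * m 1 * m 0 = -(m 0 * (m 0 * m 1))
      rw [mul_assoc, h10]; noncomm_ring
    · change m 0 * m 1 * m 1 = -(m 1 * (m 0 * m 1))
      rw [← mul_assoc (m 1), h10]; noncomm_ring
  have halg : ∀ r t : ℝ, algebraMap ℝ B r ⊗ₜ[ℝ] algebraMap ℝ M t
      = algebraMap ℝ (B ⊗[ℝ] M) (r * t) := by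
    intro r t
    rw [Algebra.algebraMap_eq_smul_one, Algebra.algebraMap_eq_smul_one, TensorProduct.smul_tmul_smul,
      Algebra.algebraMap_eq_smul_one, Algebra.TensorProduct.one_def]
  refine ⟨?_, ?_, ?_, ?_⟩
  · rintro (i | j)
    · simp only [Sum.elim_inl, Algebra.TensorProduct.tmul_mul_tmul]
      rw [hB.sq, hω, halg]
      congr 1
      have : ((-(a * b) * s i : ℤˣ) : ℤ) = -((a * b : ℤˣ) : ℤ) * (s i : ℤ) := by simp
      rw [this]
      push_cast at hab ⊢
      linear_combination ((s i : ℤ) : ℝ) * hab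
    · simp only [Sum.elim_inr, Algebra.TensorProduct.tmul_mul_tmul]
      rw [hM.sq, ← map_one (algebraMap ℝ B), ← map_mul, halg]
      simp
  · rintro (i | i) (j | j) hij
    · simp only [Sum.elim_inl, Algebra.TensorProduct.tmul_mul_tmul]
      rw [hB.anticomm i j (fun h => hij (by rw [h])), TensorProduct.neg_tmul]
    · simp only [Sum.elim_inl, Sum.elim_inr, Algebra.TensorProduct.tmul_mul_tmul]
      rw [hωm, TensorProduct.tmul_neg, mul_one, one_mul]
    · simp only [Sum.elim_inl, Sum.elim_inr, Algebra.TensorProduct.tmul_mul_tmul]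
      rw [hωm, TensorProduct.tmul_neg, mul_one, one_mul, neg_neg]
    · simp only [Sum.elim_inr, Algebra.TensorProduct.tmul_mul_tmul]
      rw [hM.anticomm i j (fun h => hij (by rw [h])), TensorProduct.tmul_neg]
  · set S := Algebra.adjoin ℝ (Set.range (Sum.elim (fun i => e i ⊗ₜ[ℝ] (m 0 * m 1))
      fun j => 1 ⊗ₜ[ℝ] m j)) with hS
    have hR : ∀ x : M, (1 : B) ⊗ₜ[ℝ] x ∈ S := by
      have : (⊤ : Subalgebra ℝ M) ≤ S.comap Algebra.TensorProduct.includeRight := by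
        rw [← hM.adjoin_eq_top, Algebra.adjoin_le_iff]
        rintro _ ⟨j, rfl⟩
        exact Algebra.subset_adjoin ⟨Sum.inr j, rfl⟩
      exact fun x => this trivial
    have hL : ∀ x : B, x ⊗ₜ[ℝ] (1 : M) ∈ S := by
      have : (⊤ : Subalgebra ℝ B) ≤ S.comap
          (Algebra.TensorProduct.includeLeft : B →ₐ[ℝ] B ⊗[ℝ] M) := by
        rw [← hB.adjoin_eq_top, Algebra.adjoin_le_iff]
        rintro _ ⟨i, rfl⟩
        have h1 : e i ⊗ₜ[ℝ] (m 0 * m 1) ∈ S := Algebra.subset_adjoin ⟨Sum.inl i, rfl⟩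
        -- Up to sign `ω` is its own inverse, so multiplying by `1 ⊗ ω` strips the twist from `e i ⊗
        -- ω`.
        have h2 := S.smul_mem (S.mul_mem h1 (hR (m 0 * m 1))) (-(((a * b : ℤˣ) : ℤ) : ℝ))
        rw [Algebra.TensorProduct.tmul_mul_tmul, hω, mul_one, ← TensorProduct.tmul_smul,
          Algebra.algebraMap_eq_smul_one, smul_smul, neg_mul_neg, hab, one_smul] at h2
        exact h2
      exact fun x => this trivial
    rw [eq_top_iff, ← Algebra.TensorProduct.adjoin_tmul_eq_top, Algebra.adjoin_le_iff]
    rintro _ ⟨x, y, rfl⟩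
    simpa using S.mul_mem (hL x) (hR y)
  · have := hB.finite
    have := hM.finite
    rw [Module.finrank_tensorProduct, hB.finrank_eq, hM.finrank_eq, Fintype.card_sum, pow_add]

end IsCliffordSystem

/-! ### Clifford algebras with at most two generators -/

section SmallSystems

theorem isCliffordSystem_real (s : Fin 0 → ℤˣ) : IsCliffordSystem s (Fin.elim0 : Fin 0 → ℝ) where
  sq i := i.elim0
  anticomm i := i.elim0
  adjoin_eq_top := eq_top_iff.2 fun x _ => Subalgebra.algebraMap_mem _ x
  finrank_eq := by simp

theorem isCliffordSystem_real_prod :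
    IsCliffordSystem (![1] : Fin 1 → ℤˣ) ![((1 : ℝ), (-1 : ℝ))] where
  sq i := by fin_cases i; simp
  anticomm i j hij := (hij (Subsingleton.elim i j)).elim
  adjoin_eq_top := by
    refine eq_top_iff.2 fun x _ => ?_
    have h : ((1 : ℝ), (-1 : ℝ)) ∈ Algebra.adjoin ℝ (Set.range ![((1 : ℝ), (-1 : ℝ))]) :=
      Algebra.subset_adjoin ⟨0, rfl⟩
    convert Subalgebra.add_mem _ (Subalgebra.algebraMap_mem _ ((x.1 + x.2) / 2))
      (Subalgebra.smul_mem _ h ((x.1 - x.2) / 2)) using 1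
    ext <;> simp <;> ring
  finrank_eq := by simp

theorem isCliffordSystem_complex :
    IsCliffordSystem (![-1] : Fin 1 → ℤˣ) ![Complex.I] where
  sq i := by fin_cases i; simp
  anticomm i j hij := (hij (Subsingleton.elim i j)).elim
  adjoin_eq_top := by
    refine eq_top_iff.2 fun x _ => ?_
    have h : Complex.I ∈ Algebra.adjoin ℝ (Set.range ![Complex.I]) :=
      Algebra.subset_adjoin ⟨0, rfl⟩
    convert Subalgebra.add_mem _ (Subalgebra.algebraMap_mem _ x.re)
      (Subalgebra.smul_mem _ h x.im) using 1
    simp [Complex.re_add_im]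
  finrank_eq := by simp

theorem isCliffordSystem_matrix (c : ℤˣ) :
    IsCliffordSystem ![1, c]
      ![!![(1 : ℝ), 0; 0, -1], !![0, ((c : ℤ) : ℝ); 1, 0]] where
  sq i := by
    fin_cases i <;> ext j k <;> fin_cases j <;> fin_cases k <;>
      simp [Matrix.mul_apply, Matrix.algebraMap_matrix_apply]
  anticomm i j hij := by
    fin_cases i <;> fin_cases j <;> first
      | exact (hij rfl).elim
      | (ext j k; fin_cases j <;> fin_cases k <;> simp [Matrix.mul_apply])
  adjoin_eq_top := by
    refine eq_top_iff.2 fun x _ => ?_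
    set S := Algebra.adjoin ℝ (Set.range
      ![!![(1 : ℝ), 0; 0, -1], !![0, ((c : ℤ) : ℝ); 1, 0]])
    have h0 : !![(1 : ℝ), 0; 0, -1] ∈ S := Algebra.subset_adjoin ⟨0, rfl⟩
    have h1 : !![0, ((c : ℤ) : ℝ); 1, 0] ∈ S := Algebra.subset_adjoin ⟨1, rfl⟩
    have hc : ((c : ℤ) : ℝ) * ((c : ℤ) : ℝ) = 1 := by
      rw [← Int.cast_mul, ← Units.val_mul, Int.units_mul_self]; simp
    -- Coordinates of `x` in the basis `1, m₀, m₁, m₀ * m₁`; since `c² = 1`, multiplying by `c`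
    -- replaces dividing by it.
    convert S.add_mem (S.add_mem (S.algebraMap_mem ((x 0 0 + x 1 1) / 2))
      (S.smul_mem h0 ((x 0 0 - x 1 1) / 2)))
      (S.add_mem (S.smul_mem h1 ((((c : ℤ) : ℝ) * x 0 1 + x 1 0) / 2))
        (S.smul_mem (S.mul_mem h0 h1) ((((c : ℤ) : ℝ) * x 0 1 - x 1 0) / 2))) using 1
    ext j k
    fin_cases j <;> fin_cases k <;>
      simp [Matrix.algebraMap_matrix_apply]
    · ring
    · linear_combination (-x 0 1) * hc
    · ring
    · ring
  finrank_eq := by simp [Module.finrank_matrix]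

theorem isCliffordSystem_quaternion :
    IsCliffordSystem (![-1, -1] : Fin 2 → ℤˣ)
      ![(⟨0, 1, 0, 0⟩ : Quaternion ℝ), (⟨0, 0, 1, 0⟩ : Quaternion ℝ)] where
  sq i := by
    fin_cases i <;> ext <;> simp
  anticomm i j hij := by
    fin_cases i <;> fin_cases j <;> first
      | exact (hij rfl).elim
      | (ext <;> simp)
  adjoin_eq_top := by
    refine eq_top_iff.2 fun x _ => ?_
    set S := Algebra.adjoin ℝ (Set.range
      ![(⟨0, 1, 0, 0⟩ : Quaternion ℝ), (⟨0, 0, 1, 0⟩ : Quaternion ℝ)])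
    have h0 : (⟨0, 1, 0, 0⟩ : Quaternion ℝ) ∈ S := Algebra.subset_adjoin ⟨0, rfl⟩
    have h1 : (⟨0, 0, 1, 0⟩ : Quaternion ℝ) ∈ S := Algebra.subset_adjoin ⟨1, rfl⟩
    convert S.add_mem (S.add_mem (S.algebraMap_mem x.re)
      (S.smul_mem h0 x.imI))
      (S.add_mem (S.smul_mem h1 x.imJ)
        (S.smul_mem (S.mul_mem h0 h1) x.imK)) using 1
    ext <;> simp
  finrank_eq := Quaternion.finrank_eq_four.trans (by simp)

end SmallSystems

/-! ### Tensor products of the basic factors -/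

section TensorTable

theorem isMatrixOver_matrix_two : IsMatrixOver (Matrix (Fin 2) (Fin 2) ℝ) ℝ :=
  .of_matrix 2 two_ne_zero .refl

/-- Both `ℂ ⊗ ℍ` and `ℂ ⊗ M(2, ℝ)` are Clifford algebras with one positive and two negative
generators. -/
theorem isMatrixOver_complex_tensor_quaternion : IsMatrixOver (ℂ ⊗[ℝ] Quaternion ℝ) ℂ := by
  have h₁ := IsCliffordSystem.tensor (a := -1) (b := -1) (s := ![1])
    (by convert isCliffordSystem_complex using 1; decide) isCliffordSystem_quaternion
  have h₂ := IsCliffordSystem.tensor (a := 1) (b := -1) (s := ![-1])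
    (by convert isCliffordSystem_complex using 1; decide) (isCliffordSystem_matrix (-1))
  have h₃ := h₁.reindex (Equiv.swap (Sum.inl 0) (Sum.inr 0))
  rw [show Sum.elim ![1] ![-1, -1] ∘ Equiv.swap (Sum.inl 0) (Sum.inr 0)
    = (Sum.elim ![-1] ![1, -1] : Fin 1 ⊕ Fin 2 → ℤˣ) by decide] at h₃
  obtain ⟨e⟩ := h₃.nonempty_algEquiv h₂
  exact (IsMatrixOver.of_algEquiv e).trans
    ((IsMatrixOver.refl.tensor isMatrixOver_matrix_two).trans .tensor_real)

/-- Both `ℍ ⊗ ℍ` and `M(2, ℝ) ⊗ M(2, ℝ)` are Clifford algebras with two positive and two negative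
generators. -/
theorem isMatrixOver_quaternion_tensor_quaternion :
    IsMatrixOver (Quaternion ℝ ⊗[ℝ] Quaternion ℝ) ℝ := by
  have h₁ := IsCliffordSystem.tensor (a := -1) (b := -1) (s := ![1, 1])
    (by convert isCliffordSystem_quaternion using 1; decide) isCliffordSystem_quaternion
  have h₂ := IsCliffordSystem.tensor (a := 1) (b := -1) (s := ![1, -1])
    (by convert isCliffordSystem_matrix (-1) using 1; decide) (isCliffordSystem_matrix (-1))
  have h₃ := h₁.reindex (Equiv.swap (Sum.inl 1) (Sum.inr 0))
  rw [show Sum.elim ![1, 1] ![-1, -1] ∘ Equiv.swap (Sum.inl 1) (Sum.inr 0)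
    = (Sum.elim ![1, -1] ![1, -1] : Fin 2 ⊕ Fin 2 → ℤˣ) by decide] at h₃
  obtain ⟨e⟩ := h₃.nonempty_algEquiv h₂
  exact (IsMatrixOver.of_algEquiv e).trans
    ((isMatrixOver_matrix_two.tensor isMatrixOver_matrix_two).trans .tensor_real)

theorem isMatrixOver_complex_tensor_complex : IsMatrixOver (ℂ ⊗[ℝ] ℂ) (ℂ × ℂ) := by
  let f : ℂ ⊗[ℝ] ℂ →ₐ[ℝ] ℂ × ℂ := Algebra.TensorProduct.lift
    ((AlgHom.id ℝ ℂ).prod (AlgHom.id ℝ ℂ)) ((AlgHom.id ℝ ℂ).prod Complex.conjAe.toAlgHom)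
    fun _ _ => Commute.all _ _
  have hf : ∀ x y, f (x ⊗ₜ y) = (x * y, x * starRingEnd ℂ y) := fun x y => by
    simp [f, Algebra.TensorProduct.lift_tmul]
  have hsurj : Function.Surjective f := by
    rintro ⟨a, b⟩
    -- The map is `x ⊗ y ↦ (x * y, x * conj y)`: it sends `x ⊗ 1` to `(x, x)` and `x ⊗ I` to `(x *
    -- I, -x * I)`, so the half sum and half difference of `a` and `b` are matched separately.
    refine ⟨((a + b) / 2) ⊗ₜ 1 + ((a - b) / (2 * Complex.I)) ⊗ₜ Complex.I, ?_⟩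
    rw [map_add, hf, hf]
    ext1
    · simp; field_simp; ring
    · simp; field_simp; ring
  exact .of_algEquiv (AlgEquiv.ofBijective f
    ⟨(LinearMap.injective_iff_surjective_of_finrank_eq_finrank (f := f.toLinearMap)
      (by simp)).2 hsurj, hsurj⟩)

/-- The name of the algebra over which the tensor product of matrix algebras over two named
algebras is a matrix algebra, if there is one. -/
def Factor.mul : Factor → Factor → Option Factor
  | .R, f => some f
  | f, .R => some f
  | .RR, .RR => some .RRRR
  | .RR, .C => some .CC
  | .C, .RR => some .CC
  | .RR, .H => some .HH
  | .H, .RR => some .HH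
  | .RR, .HH => some .HHHH
  | .HH, .RR => some .HHHH
  | .C, .C => some .CC
  | .C, .H => some .C
  | .H, .C => some .C
  | .C, .HH => some .CC
  | .HH, .C => some .CC
  | .H, .H => some .R
  | .H, .HH => some .RR
  | .HH, .H => some .RR
  | .HH, .HH => some .RRRR
  | _, _ => none

open IsMatrixOver in
-- Tensor products distribute over direct sums, so everything reduces to `ℂ ⊗ ℂ`, `ℂ ⊗ ℍ` and `ℍ ⊗
-- ℍ`. The undefined products involve a factor with four summands or `ℂ × ℂ`, which no single
-- Clifford algebra produces.
theorem IsMatrixOverFactor.tensor {A B : Type*} [Ring A] [Algebra ℝ A] [Ring B] [Algebra ℝ B]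
    {f g h : Factor} (hA : IsMatrixOverFactor A f) (hB : IsMatrixOverFactor B g)
    (hfg : f.mul g = some h) : IsMatrixOverFactor (A ⊗[ℝ] B) h := by
  have hCH := isMatrixOver_complex_tensor_quaternion
  have hHH := isMatrixOver_quaternion_tensor_quaternion
  have hCC := isMatrixOver_complex_tensor_complex
  cases f <;> cases g <;> simp only [Factor.mul, reduceCtorEq, Option.some.injEq] at hfg <;>
    subst hfg <;> refine (IsMatrixOver.tensor hA hB).trans ?_ <;> first
      | exact tensor_real
      | exact tensor_real.tensor_symm
      | exact hCC
      | exact hCH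
      | exact hCH.tensor_symm
      | exact hHH
      | exact tensor_real.tensor_prod
      | exact tensor_real.tensor_prod.tensor_symm
      | exact hCH.tensor_prod
      | exact hCH.tensor_prod.tensor_symm
      | exact hHH.tensor_prod
      | exact hHH.tensor_prod.tensor_symm
      | exact (tensor_prod tensor_real).prod_assoc
      | exact (tensor_prod tensor_real).prod_assoc.tensor_symm
      | exact (tensor_prod hHH.tensor_prod.tensor_symm).prod_assoc

end TensorTable

/-! ### Periodicity modulo 8 -/

open Factor in
/-- The name of the algebra over which the Clifford algebra of signature `(p, q)` with
`p - q = t` is a matrix algebra. -/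
def cliffordFactor (t : ℤ) : Factor :=
  ![R, RR, R, C, H, HH, H, C] (Fin.ofNat 8 (t % 8).toNat)

/-- The numerical form of splitting off two positive generators: the remaining signs flip and the
matrix factor `M(2, ℝ)` is invisible. -/
theorem cliffordFactor_neg (t : ℤ) : cliffordFactor (-t) = cliffordFactor (t + 2) := by
  unfold cliffordFactor
  rw [show (-t) % 8 = (-(t % 8)) % 8 by omega, show (t + 2) % 8 = (t % 8 + 2) % 8 by omega]
  have h₀ : 0 ≤ t % 8 := by omega
  have h₈ : t % 8 < 8 := by omega
  generalize t % 8 = r at *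
  interval_cases r <;> rfl

/-- The same for two negative generators, which leave a factor `ℍ`. -/
theorem cliffordFactor_neg_mul (t : ℤ) :
    (cliffordFactor (-t)).mul .H = some (cliffordFactor (t + -2)) := by
  unfold cliffordFactor
  rw [show (-t) % 8 = (-(t % 8)) % 8 by omega, show (t + -2) % 8 = (t % 8 - 2) % 8 by omega]
  have h₀ : 0 ≤ t % 8 := by omega
  have h₈ : t % 8 < 8 := by omega
  generalize t % 8 = r at *
  interval_cases r <;> rfl

/-- A finite check. The choice of `a` is immaterial because it replaces `t = 1 - a * (c - r)` by `2
- t`, a symmetry of `cliffordFactor`. Only `r` modulo 4 matters because shifting `r` by 4 shifts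
both arguments by 4 modulo 8, which tensors each factor with `ℍ`, and `ℍ ⊗ ℍ` is a matrix algebra
over `ℝ`. -/
theorem cliffordFactor_mul_cliffordFactor (r c : ℤ) (a : ℤˣ) :
    (cliffordFactor r).mul (cliffordFactor (1 - a * (c - r))) = some (factorOf r c) := by
  have key : (1 - (a : ℤ) * (c - r)) % 8 = (1 - (a : ℤ) * (c % 8 - r % 8)) % 8 := by
    rcases Int.units_eq_one_or a with rfl | rfl <;> push_cast <;> omega
  unfold cliffordFactor factorOf
  rw [key, show r % 4 = (r % 8) % 4 by omega]
  have h₀ : 0 ≤ r % 8 := by omega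
  have h₈ : r % 8 < 8 := by omega
  have h₀' : 0 ≤ c % 8 := by omega
  have h₈' : c % 8 < 8 := by omega
  generalize r % 8 = x at *
  generalize c % 8 = y at *
  clear key
  rcases Int.units_eq_one_or a with rfl | rfl <;> interval_cases x <;> interval_cases y <;> rfl

theorem isMatrixOverFactor_signForm : ∀ (n : ℕ) (s : Fin n → ℤˣ),
    IsMatrixOverFactor (CliffordAlgebra (signForm s)) (cliffordFactor (∑ i, (s i : ℤ)))
  | 0, s => by
    obtain ⟨f⟩ := (isCliffordSystem_real s).nonempty_algEquiv_signForm
    exact .of_algEquiv f (IsMatrixOver.refl (A := ℝ))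
  | 1, s => by
    rcases Int.units_eq_one_or (s 0) with h | h
    · obtain rfl : s = ![1] := by ext i; simp [Subsingleton.elim i 0, h]
      obtain ⟨f⟩ := isCliffordSystem_real_prod.nonempty_algEquiv_signForm
      exact .of_algEquiv f (IsMatrixOver.refl (A := ℝ × ℝ))
    · obtain rfl : s = ![-1] := by ext i; simp [Subsingleton.elim i 0, h]
      obtain ⟨f⟩ := isCliffordSystem_complex.nonempty_algEquiv_signForm
      exact .of_algEquiv f (IsMatrixOver.refl (A := ℂ))
  | n + 2, s => by
    set s' : Fin n → ℤˣ := fun i => s (Fin.castAdd 2 i)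
    set a := s (Fin.natAdd n 0)
    set b := s (Fin.natAdd n 1)
    have hs : s ∘ finSumFinEquiv = Sum.elim s' ![a, b] := by
      ext (i | j)
      · simp [s']
      · fin_cases j <;> simp [a, b]
    have hA := (isCliffordSystem_signForm s).reindex finSumFinEquiv
    rw [hs] at hA
    have hsum : ∑ i, (s i : ℤ) = ∑ i, (s' i : ℤ) + ((a : ℤ) + b) := by
      rw [← finSumFinEquiv.sum_comp, Fintype.sum_sum_type, Fin.sum_univ_two]
      simp [s', a, b]
    rw [hsum]
    have hB := isCliffordSystem_signForm fun i => -(a * b) * s' i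
    have ih := isMatrixOverFactor_signForm n fun i => -(a * b) * s' i
    clear_value a b s'
    -- Equal signs `a = b` flip the remaining signs; opposite ones leave them alone. Only `a = b =
    -- -1` gives `ℍ` in place of `M(2, ℝ)`.
    rcases Int.units_eq_one_or a with rfl | rfl <;> rcases Int.units_eq_one_or b with rfl | rfl
    · obtain ⟨f⟩ := hA.nonempty_algEquiv (hB.tensor (isCliffordSystem_matrix 1))
      refine .of_algEquiv f (.tensor_matrix ?_ isMatrixOver_matrix_two)
      convert ih using 1
      simp [Finset.sum_neg_distrib, cliffordFactor_neg]
    · obtain ⟨f⟩ := hA.nonempty_algEquiv (hB.tensor (isCliffordSystem_matrix (-1)))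
      refine .of_algEquiv f (.tensor_matrix ?_ isMatrixOver_matrix_two)
      convert ih using 1
      simp
    · have hM := (isCliffordSystem_matrix (-1)).reindex (Equiv.swap 0 1)
      rw [show ![1, -1] ∘ Equiv.swap (0 : Fin 2) 1 = (![-1, 1] : Fin 2 → ℤˣ) by decide] at hM
      obtain ⟨f⟩ := hA.nonempty_algEquiv (hB.tensor hM)
      refine .of_algEquiv f (.tensor_matrix ?_ isMatrixOver_matrix_two)
      convert ih using 1
      simp
    · obtain ⟨f⟩ := hA.nonempty_algEquiv (hB.tensor isCliffordSystem_quaternion)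
      refine .of_algEquiv f (ih.tensor (g := .H) (IsMatrixOver.refl (A := Quaternion ℝ)) ?_)
      convert cliffordFactor_neg_mul (∑ i, (s' i : ℤ)) using 2
      · simp [Finset.sum_neg_distrib]
      · rfl

theorem IsCliffordSystem.isMatrixOverFactor {ι A : Type*} [Fintype ι] [Ring A] [Algebra ℝ A]
    {s : ι → ℤˣ} {e : ι → A} (h : IsCliffordSystem s e) :
    IsMatrixOverFactor A (cliffordFactor (∑ i, (s i : ℤ))) := by
  obtain ⟨f⟩ := (h.reindex (Fintype.equivFin ι).symm).nonempty_algEquiv_signForm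
  refine .of_algEquiv f.symm ?_
  convert isMatrixOverFactor_signForm _ (s ∘ (Fintype.equivFin ι).symm) using 2
  exact ((Fintype.equivFin ι).symm.sum_comp fun i => (s i : ℤ)).symm

/-! ### The even part as a tensor product of two Clifford algebras -/

/-- Centralizers are subalgebras, so commutation passes from generators to everything, one variable
at a time. -/
theorem AlgHom.commute_of_adjoin {A B C : Type*} [Ring A] [Algebra ℝ A] [Ring B] [Algebra ℝ B]
    [Ring C] [Algebra ℝ C] (f : B →ₐ[ℝ] A) (g : C →ₐ[ℝ] A) {s : Set B} {t : Set C}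
    (hs : Algebra.adjoin ℝ s = ⊤) (ht : Algebra.adjoin ℝ t = ⊤)
    (h : ∀ x ∈ s, ∀ y ∈ t, Commute (f x) (g y)) (x : B) (y : C) : Commute (f x) (g y) := by
  have h₁ : ∀ x, ∀ y ∈ t, Commute (f x) (g y) := by
    have : (⊤ : Subalgebra ℝ B) ≤ (Subalgebra.centralizer ℝ (g '' t)).comap f := by
      rw [← hs, Algebra.adjoin_le_iff]
      rintro x hx _ ⟨y, hy, rfl⟩
      exact (h x hx y hy).symm
    exact fun x y hy => (this (x := x) trivial (g y) ⟨y, hy, rfl⟩).symm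
  have h₂ : (⊤ : Subalgebra ℝ C) ≤ (Subalgebra.centralizer ℝ (Set.range f)).comap g := by
    rw [← ht, Algebra.adjoin_le_iff]
    rintro y hy _ ⟨x, rfl⟩
    exact h₁ x y hy
  exact h₂ (x := y) trivial (f x) ⟨x, rfl⟩

theorem Fintype.card_subtype_add_card_subtype_not_ne {ι : Type*} [Fintype ι] [DecidableEq ι]
    (P : ι → Prop) [DecidablePred P] (o : ι) (ho : ¬P o) :
    Fintype.card {i // P i} + Fintype.card {j // ¬P j ∧ j ≠ o} + 1 = Fintype.card ι := by
  have h₁ := Fintype.card_subtype_compl P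
  have h₂ := Fintype.card_subtype_le P
  have h₃ : Fintype.card {j // ¬P j ∧ j ≠ o} + 1 = Fintype.card {j // ¬P j} := by
    simp only [Fintype.card_subtype]
    rw [← Finset.card_erase_add_one (s := {j | ¬P j}) (a := o) (by simpa using ho)]
    congr 2
    ext j
    simp [and_comm]
  omega

section EvenPart

variable {ι A : Type*} [Fintype ι] [Ring A] [Algebra ℝ A] {s : ι → ℤˣ} {e : ι → A}

/-- Each `e i` with `i` even anticommutes with both `e o` and `e j`, hence commutes with `e o * e
j`; this yields a map `Φ` from the tensor product to the even part. It is bijective because `A` is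
the sum of its image and `e o` times its image, and the dimensions leave no room for a kernel. -/
theorem IsCliffordSystem.exists_even_equiv (h : IsCliffordSystem s e) (G : Z2Grading A)
    (P : ι → Prop) [DecidablePred P] [DecidableEq ι] (h0 : ∀ i, P i → e i ∈ G.part 0)
    (h1 : ∀ i, ¬P i → e i ∈ G.part 1) (o : ι) (ho : ¬P o) :
    Nonempty (CliffordAlgebra (signForm fun i : {i // P i} => s i) ⊗[ℝ]
      CliffordAlgebra (signForm fun j : {j // ¬P j ∧ j ≠ o} => -(s o) * s j) ≃ₐ[ℝ]
        G.evenSubalgebra) := by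
  have hbe := isCliffordSystem_signForm fun i : {i // P i} => s i
  have hbo := isCliffordSystem_signForm fun j : {j // ¬P j ∧ j ≠ o} => -(s o) * s j
  have hsq : ∀ i, e i * e i = algebraMap ℝ A ((s i : ℤ) : ℝ) := h.sq
  have hoo : (((s o : ℤˣ) : ℤ) : ℝ) * (((s o : ℤˣ) : ℤ) : ℝ) = 1 := by
    rw [← Int.cast_mul, ← Units.val_mul, Int.units_mul_self]; simp
  have hmem : ∀ j, ¬P j → e o * e j ∈ G.part 0 := fun j hj =>
    G.mul_mem 1 1 _ _ (h1 o ho) (h1 j hj)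
  have hsw : ∀ i j k, i ≠ j → e i * (e j * k) = -(e j * (e i * k)) := fun i j k hij => by
    rw [← mul_assoc, h.anticomm i j hij, neg_mul, mul_assoc]
  have hself : ∀ i k, e i * (e i * k) = ((s i : ℤ) : ℝ) • k := fun i k => by
    rw [← mul_assoc, hsq, ← Algebra.smul_def]
  let ee : {i // P i} → G.evenSubalgebra := fun i => ⟨e i, h0 i i.2⟩
  let eo : {j // ¬P j ∧ j ≠ o} → G.evenSubalgebra := fun j => ⟨e o * e j, hmem j j.2.1⟩
  obtain ⟨φ₁, hφ₁⟩ := exists_cliffordAlgebra_lift (A := G.evenSubalgebra) (Pi.basisFun ℝ _)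
    (signForm_basis fun i : {i // P i} => s i) (polar_signForm_basis _) (e := ee)
    (fun i => Subtype.ext (hsq i))
    (fun i j hij => Subtype.ext (h.anticomm i j fun hh => hij (Subtype.ext hh)))
  obtain ⟨φ₂, hφ₂⟩ := exists_cliffordAlgebra_lift (A := G.evenSubalgebra) (Pi.basisFun ℝ _)
    (signForm_basis fun j : {j // ¬P j ∧ j ≠ o} => -(s o) * s j) (polar_signForm_basis _) (e := eo)
    (fun j => Subtype.ext (by
      change e o * e j * (e o * e j) = algebraMap ℝ A _
      rw [mul_assoc, hsw j o _ j.2.2, hsq, mul_neg, hself, Algebra.smul_def, ← map_mul, ← map_neg]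
      simp))
    (fun i j hij => Subtype.ext (by
      change e o * e i * (e o * e j) = -(e o * e j * (e o * e i))
      rw [mul_assoc, hsw i o _ i.2.2, mul_assoc, hsw j o _ j.2.2,
        h.anticomm i j fun hh => hij (Subtype.ext hh)]
      simp))
  let Φ := Algebra.TensorProduct.lift φ₁ φ₂
    (AlgHom.commute_of_adjoin φ₁ φ₂ hbe.adjoin_eq_top hbo.adjoin_eq_top (by
      rintro _ ⟨i, rfl⟩ _ ⟨j, rfl⟩
      have hio : (i : ι) ≠ o := fun hh => ho (hh ▸ i.2)
      have hij : (i : ι) ≠ j := fun hh => j.2.1 (hh ▸ i.2)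
      rw [hφ₁, hφ₂]
      refine Subtype.ext ?_
      change e i * (e o * e j) = e o * e j * e i
      rw [hsw i o _ hio, h.anticomm i j hij, mul_assoc, mul_neg, neg_neg]))
  have hΦe : ∀ i (hi : P i), ∃ g, (Φ g : A) = e i := fun i hi =>
    ⟨CliffordAlgebra.ι _ (Pi.basisFun ℝ _ ⟨i, hi⟩) ⊗ₜ 1, by
      simp only [Φ, Algebra.TensorProduct.lift_tmul, map_one, mul_one, hφ₁, ee]⟩
  have hΦo : ∀ j (hj : ¬P j ∧ j ≠ o), ∃ g, (Φ g : A) = e o * e j := fun j hj =>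
    ⟨1 ⊗ₜ CliffordAlgebra.ι _ (Pi.basisFun ℝ _ ⟨j, hj⟩), by
      simp only [Φ, Algebra.TensorProduct.lift_tmul, map_one, one_mul, hφ₂, eo]⟩
  clear_value Φ
  let j := G.evenSubalgebra.val.toLinearMap ∘ₗ Φ.toLinearMap
  let Ψ := j.coprod (LinearMap.mulLeft ℝ (e o) ∘ₗ j)
  have hΨ : ∀ x y, Ψ (x, y) = Φ x + e o * Φ y := fun x y => rfl
  -- The range of `Ψ` is a left ideal; as it contains `1`, it is all of `A`.
  have hstab : ∀ a ∈ Algebra.adjoin ℝ (Set.range e), ∀ u ∈ LinearMap.range Ψ,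
      a * u ∈ LinearMap.range Ψ := by
    intro a ha
    induction ha using Algebra.adjoin_induction with
    | mem a ha =>
      obtain ⟨i, rfl⟩ := ha
      rintro _ ⟨⟨x, y⟩, rfl⟩
      by_cases hi : P i
      · obtain ⟨g, hg⟩ := hΦe i hi
        refine ⟨(g * x, -(g * y)), ?_⟩
        have hio : i ≠ o := fun hh => ho (hh ▸ hi)
        rw [hΨ, hΨ, mul_add, hsw i o _ hio, ← hg]
        simp
      · rcases eq_or_ne i o with rfl | hio
        · refine ⟨(((s i : ℤ) : ℝ) • y, x), ?_⟩
          rw [hΨ, hΨ, mul_add, hself, add_comm, map_smul]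
          rfl
        · obtain ⟨g, hg⟩ := hΦo i ⟨hi, hio⟩
          -- Here `g` maps to `e o * e i`, and `e i = s o • e o * (e o * e i)`.
          refine ⟨(-(g * y), ((s o : ℤ) : ℝ) • (g * x)), ?_⟩
          rw [hΨ, hΨ, mul_add, hsw i o _ hio]
          have h₁ : ((Φ (-(g * y)) : G.evenSubalgebra) : A) = -(e o * (e i * Φ y)) := by
            rw [map_neg, map_mul, NegMemClass.coe_neg, MulMemClass.coe_mul, hg, mul_assoc]
          have h₂ : ((Φ (((s o : ℤ) : ℝ) • (g * x)) : G.evenSubalgebra) : A)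
              = ((s o : ℤ) : ℝ) • (e o * (e i * Φ x)) := by
            rw [map_smul, map_mul, SetLike.val_smul, MulMemClass.coe_mul, hg, mul_assoc]
          rw [h₁, h₂, mul_smul_comm, hself, smul_smul, hoo, one_smul, add_comm]
    | algebraMap r =>
      intro u hu
      rw [← Algebra.smul_def]
      exact Submodule.smul_mem _ _ hu
    | add a b _ _ iha ihb =>
      intro u hu
      rw [add_mul]
      exact Submodule.add_mem _ (iha u hu) (ihb u hu)
    | mul a b _ _ iha ihb =>
      intro u hu
      rw [mul_assoc]
      exact iha _ (ihb u hu)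
  have hΨs : Function.Surjective Ψ := fun a => by
    have h₁ : (1 : A) ∈ LinearMap.range Ψ := ⟨(1, 0), by simp [hΨ]⟩
    simpa using hstab a (by rw [h.adjoin_eq_top]; trivial) 1 h₁
  have hΦs : Function.Surjective Φ := by
    rintro ⟨a, ha⟩
    obtain ⟨⟨x, y⟩, hxy⟩ := hΨs a
    refine ⟨x, Subtype.ext ?_⟩
    -- If `a = Φ x + e o * Φ y` is even, then the last summand is both odd and even, hence zero.
    have hy : e o * Φ y ∈ G.part 1 := by simpa using G.mul_mem 1 0 _ _ (h1 o ho) (Φ y).2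
    have hxy' : a - Φ x = e o * Φ y := by rw [← hxy, hΨ, add_sub_cancel_left]
    exact (sub_eq_zero.1 (Submodule.disjoint_def.1 G.isCompl.disjoint _
      ((G.part 0).sub_mem ha (Φ x).2) (hxy' ▸ hy))).symm
  have hcard := Fintype.card_subtype_add_card_subtype_not_ne P o ho
  have := hbe.finite
  have := hbo.finite
  have := h.finite
  have hΨi : Function.Injective Ψ := by
    refine (LinearMap.injective_iff_surjective_of_finrank_eq_finrank ?_).2 hΨs
    rw [Module.finrank_prod, Module.finrank_tensorProduct, hbe.finrank_eq, hbo.finrank_eq,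
      h.finrank_eq, ← hcard, pow_succ, pow_add, mul_two]
  refine ⟨AlgEquiv.ofBijective Φ ⟨fun x y hxy => ?_, hΦs⟩⟩
  have : Ψ (x, 0) = Ψ (y, 0) := by rw [hΨ, hΨ, hxy]
  exact congrArg Prod.fst (hΨi this)

theorem IsCliffordSystem.isMatrixOverFactor_even (h : IsCliffordSystem s e) (G : Z2Grading A)
    (P : ι → Prop) [DecidablePred P] (h0 : ∀ i, P i → e i ∈ G.part 0)
    (h1 : ∀ i, ¬P i → e i ∈ G.part 1) (o : ι) (ho : ¬P o) :
    IsMatrixOverFactor G.evenSubalgebra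
      (factorOf (∑ i with P i, (s i : ℤ)) (∑ i, (s i : ℤ))) := by
  classical
  obtain ⟨f⟩ := h.exists_even_equiv G P h0 h1 o ho
  refine .of_algEquiv f.symm ((isCliffordSystem_signForm _).isMatrixOverFactor.tensor
    (isCliffordSystem_signForm _).isMatrixOverFactor ?_)
  rw [← cliffordFactor_mul_cliffordFactor _ _ (s o)]
  congr 2
  · exact (Finset.sum_subtype _ (by simp) fun i => (s i : ℤ)).symm
  · rw [← Finset.sum_filter_add_sum_filter_not Finset.univ P fun i => (s i : ℤ),
      add_sub_cancel_left, ← Finset.sum_erase_add _ _ (a := o) (by simpa using ho),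
      Finset.sum_subtype (p := fun j => ¬P j ∧ j ≠ o) _ (by simp [and_comm])]
    -- Leaving out `e o` accounts for the constant 1: `-s o * (S - s o) = 1 - s o * S`, with `S` the
    -- sum of all odd signs.
    have hoo : (s o : ℤ) * s o = 1 := by rw [← Units.val_mul, Int.units_mul_self]; rfl
    simp only [Units.val_mul, Units.val_neg, neg_mul, Finset.sum_neg_distrib, mul_add, hoo,
      ← Finset.mul_sum]
    ring

theorem IsCliffordSystem.finrank_even (h : IsCliffordSystem s e) (G : Z2Grading A)
    (P : ι → Prop) (h0 : ∀ i, P i → e i ∈ G.part 0)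
    (h1 : ∀ i, ¬P i → e i ∈ G.part 1) (o : ι) (ho : ¬P o) :
    Module.finrank ℝ G.evenSubalgebra = 2 ^ (Fintype.card ι - 1) := by
  classical
  obtain ⟨f⟩ := h.exists_even_equiv G P h0 h1 o ho
  have hbe := isCliffordSystem_signForm fun i : {i // P i} => s i
  have hbo := isCliffordSystem_signForm fun j : {j // ¬P j ∧ j ≠ o} => -(s o) * s j
  rw [← f.toLinearEquiv.finrank_eq, Module.finrank_tensorProduct, hbe.finrank_eq, hbo.finrank_eq,
    ← pow_add, ← Fintype.card_subtype_add_card_subtype_not_ne P o ho, Nat.add_sub_cancel]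

end EvenPart

/-! ### The centre as an obstruction -/

section Center

variable {A B D : Type*} [Ring A] [Algebra ℝ A] [Ring B] [Algebra ℝ B] [Ring D] [Algebra ℝ D]

theorem AlgEquiv.finrank_center_eq (f : A ≃ₐ[ℝ] B) :
    Module.finrank ℝ (Subalgebra.center ℝ A) = Module.finrank ℝ (Subalgebra.center ℝ B) := by
  have h : (Subalgebra.center ℝ A).map f.toAlgHom = Subalgebra.center ℝ B := by
    ext y
    simp only [Subalgebra.mem_map, Subalgebra.mem_center_iff]
    constructor
    · rintro ⟨x, hx, rfl⟩ z
      obtain ⟨z, rfl⟩ := f.surjective z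
      simpa using congrArg f (hx z)
    · intro hy
      exact ⟨f.symm y, fun z => f.injective (by simpa using hy (f z)), by simp⟩
  rw [← h]
  exact ((Subalgebra.center ℝ A).equivMapOfInjective f.toAlgHom f.injective).toLinearEquiv.finrank_eq

theorem finrank_center_prod [Module.Finite ℝ A] [Module.Finite ℝ B] :
    Module.finrank ℝ (Subalgebra.center ℝ (A × B)) =
      Module.finrank ℝ (Subalgebra.center ℝ A) + Module.finrank ℝ (Subalgebra.center ℝ B) := by
  rw [Subalgebra.center_prod, ← Module.finrank_prod]
  exact LinearEquiv.finrank_eq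
    { toFun := fun x => (⟨x.1.1, x.2.1⟩, ⟨x.1.2, x.2.2⟩)
      invFun := fun x => ⟨(x.1, x.2), x.1.2, x.2.2⟩
      map_add' := fun _ _ => rfl
      map_smul' := fun _ _ => rfl }

/-- Central matrices are the scalar ones with central entry; `k ≠ 0` makes the entry recoverable. -/
theorem IsMatrixOver.finrank_center_eq (h : IsMatrixOver A D) :
    Module.finrank ℝ (Subalgebra.center ℝ A) = Module.finrank ℝ (Subalgebra.center ℝ D) := by
  obtain ⟨k, hk, ⟨f⟩⟩ := h
  have : NeZero k := ⟨hk⟩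
  rw [(f.trans ((Algebra.TensorProduct.comm ℝ _ _).trans
    (matrixEquivTensor (Fin k) ℝ D).symm)).finrank_center_eq,
    Matrix.subalgebraCenter_eq_scalarAlgHom_map]
  exact ((Subalgebra.center ℝ D).equivMapOfInjective (Matrix.scalarAlgHom (Fin k) ℝ)
    fun x y hxy => by simpa using congrFun (congrFun hxy 0) 0).symm.toLinearEquiv.finrank_eq

theorem finrank_center_of_comm {K : Type*} [CommRing K] [Algebra ℝ K] :
    Module.finrank ℝ (Subalgebra.center ℝ K) = Module.finrank ℝ K := by
  rw [show Subalgebra.center ℝ K = ⊤ from Subalgebra.center_eq_top ℝ K]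
  exact Subalgebra.topEquiv.toLinearEquiv.finrank_eq

theorem finrank_center_quaternion :
    Module.finrank ℝ (Subalgebra.center ℝ (Quaternion ℝ)) = 1 := by
  rw [show Subalgebra.center ℝ (Quaternion ℝ) = ⊥ from ?_, Subalgebra.finrank_bot]
  refine eq_bot_iff.2 fun x hx => Algebra.mem_bot.2 ⟨x.re, ?_⟩
  rw [Subalgebra.mem_center_iff] at hx
  -- Commuting with `i` and `j` already forces the imaginary part to vanish.
  obtain ⟨u, hu⟩ : ∃ u : Quaternion ℝ, u.re = 0 ∧ u.imI = 1 ∧ u.imJ = 0 ∧ u.imK = 0 :=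
    ⟨⟨0, 1, 0, 0⟩, rfl, rfl, rfl, rfl⟩
  obtain ⟨v, hv⟩ : ∃ v : Quaternion ℝ, v.re = 0 ∧ v.imI = 0 ∧ v.imJ = 1 ∧ v.imK = 0 :=
    ⟨⟨0, 0, 1, 0⟩, rfl, rfl, rfl, rfl⟩
  have hi := Quaternion.ext_iff.1 (hx u)
  have hj := Quaternion.ext_iff.1 (hx v)
  simp only [Quaternion.re_mul, Quaternion.imI_mul, Quaternion.imJ_mul, Quaternion.imK_mul,
    hu, hv, zero_mul, mul_zero, one_mul, mul_one, zero_add, add_zero, sub_zero, zero_sub] at hi hj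
  refine Quaternion.ext _ _ rfl ?_ ?_ ?_
  · change 0 = x.imI; linarith
  · change 0 = x.imJ; linarith
  · change 0 = x.imK; linarith

/-- The dimension of the centre of the algebra with the given name. -/
def Factor.centerDim : Factor → ℕ
  | .R => 1
  | .RR => 2
  | .RRRR => 4
  | .C => 2
  | .CC => 4
  | .H => 1
  | .HH => 2
  | .HHHH => 4

theorem IsMatrixOverFactor.finrank_center_eq {f : Factor} (h : IsMatrixOverFactor A f) :
    Module.finrank ℝ (Subalgebra.center ℝ A) = f.centerDim := by
  cases f <;> refine (IsMatrixOver.finrank_center_eq h).trans ?_ <;>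
    simp [finrank_center_prod, finrank_center_of_comm, finrank_center_quaternion, Factor.centerDim]

theorem centerDim_cliffordFactor_le (t : ℤ) : (cliffordFactor t).centerDim ≤ 2 := by
  unfold cliffordFactor
  have h₀ : 0 ≤ t % 8 := by omega
  have h₈ : t % 8 < 8 := by omega
  generalize t % 8 = r at *
  interval_cases r <;> decide

theorem centerDim_factorOf {r c : ℤ} (hc : c ≡ 1 [ZMOD 4]) (hr : r ≡ 1 [ZMOD 4]) :
    (factorOf r c).centerDim = 4 := by
  unfold factorOf
  have hr' : r % 4 = 1 := hr
  have hc' : c % 4 = 1 := hc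
  have h₈ : c % 8 = 1 ∨ c % 8 = 5 := by omega
  rw [hr']
  rcases h₈ with h | h <;> rw [h] <;> rfl

end Center

/-! ### Orthonormal and adapted bases -/

theorem exists_units_eq {ι : Type*} {x : ι → ℝ} (h : ∀ i, x i = 1 ∨ x i = -1) :
    ∃ s : ι → ℤˣ, ∀ i, x i = ((s i : ℤ) : ℝ) := by
  choose s hs using fun i => show ∃ s : ℤˣ, x i = ((s : ℤ) : ℝ) from
    (h i).elim (fun h => ⟨1, by simp [h]⟩) fun h => ⟨-1, by simp [h]⟩
  exact ⟨s, hs⟩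

theorem exists_orthonormal_basis {W : Type*} [AddCommGroup W] [Module ℝ W]
    [FiniteDimensional ℝ W] (Q : QuadraticForm ℝ W)
    (hQ : ∀ x, (∀ y, QuadraticMap.polar Q x y = 0) → x = 0) :
    ∃ b : Module.Basis (Fin (Module.finrank ℝ W)) ℝ W, (∀ i, Q (b i) = 1 ∨ Q (b i) = -1) ∧
      ∀ i j, i ≠ j → QuadraticMap.polar Q (b i) (b j) = 0 := by
  have hQ' : (QuadraticMap.associated Q).SeparatingLeft := fun x hx =>
    hQ x fun y => by
      have h := hx y
      rw [QuadraticMap.associated_apply] at h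
      simpa [QuadraticMap.polar] using h
  obtain ⟨w, hw, ⟨f⟩⟩ := QuadraticForm.equivalent_one_neg_one_weighted_sum_squared Q hQ'
  obtain ⟨s, hs⟩ := exists_units_eq fun i => (hw i).symm
  obtain rfl : w = fun i => ((s i : ℤ) : ℝ) := funext hs
  refine ⟨(Pi.basisFun ℝ _).map f.symm.toLinearEquiv, fun i => ?_, fun i j hij => ?_⟩
  · have h : Q (f.symm (Pi.basisFun ℝ _ i)) = ((s i : ℤ) : ℝ) :=
      (f.symm.map_app _).trans (signForm_basis s i)
    exact h ▸ (hw i).symm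
  · rw [← polar_signForm_basis s i j hij]
    change QuadraticMap.polar Q (f.symm (Pi.basisFun ℝ _ i)) (f.symm (Pi.basisFun ℝ _ j)) = _
    simp only [QuadraticMap.polar, ← map_add, QuadraticMap.IsometryEquiv.map_app]
    rfl

theorem polar_separating {W : Type*} [AddCommGroup W] [Module ℝ W] {Q : QuadraticForm ℝ W}
    (hQ : (QuadraticMap.associated Q).Nondegenerate) (x : W)
    (hx : ∀ y, QuadraticMap.polar Q x y = 0) : x = 0 :=
  (QuadraticMap.nondegenerate_polar_iff.2 (QuadraticMap.nondegenerate_associated_iff.1 hQ)).1 x hx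

/-- By Sylvester's theorem a nondegenerate form has an orthonormal basis, so its Clifford algebra
falls under the periodicity table, where every centre has dimension 1 or 2. -/
theorem notClifford_of_finrank_center {A : Type u} [Ring A] [Algebra ℝ A]
    (h : 2 < Module.finrank ℝ (Subalgebra.center ℝ A)) : NotClifford.{w} A := by
  intro W _ _ _ Q hQ
  refine ⟨fun f => ?_⟩
  obtain ⟨b, hb, hbo⟩ := exists_orthonormal_basis Q (polar_separating hQ)
  obtain ⟨s, hs⟩ := exists_units_eq hb
  rw [f.finrank_center_eq, (isCliffordSystem_basis b hs hbo).isMatrixOverFactor.finrank_center_eq] at h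
  exact absurd (centerDim_cliffordFactor_le _) (not_le.2 h)

section AdaptedBasis

variable {V : Type*} [AddCommGroup V] [Module ℝ V] {Q : QuadraticForm ℝ V}

theorem exists_orthonormal_basis_submodule [FiniteDimensional ℝ V] (U : Submodule ℝ V)
    (hU : ∀ x ∈ U, (∀ y ∈ U, QuadraticMap.polar Q x y = 0) → x = 0) :
    ∃ b : Module.Basis (Fin (Module.finrank ℝ U)) ℝ U, (∀ i, Q (b i) = 1 ∨ Q (b i) = -1) ∧
      ∀ i j, i ≠ j → QuadraticMap.polar Q (b i) (b j) = 0 :=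
  exists_orthonormal_basis (Q.comp U.subtype) fun x hx =>
    Subtype.ext (hU x x.2 fun y hy => hx ⟨y, hy⟩)

namespace Z2Grading

/-- The space of vectors of given parity. -/
def vectors (G : Z2Grading (CliffordAlgebra Q)) (i : ZMod 2) : Submodule ℝ V :=
  (G.part i).comap (CliffordAlgebra.ι Q)

variable {G : Z2Grading (CliffordAlgebra Q)}

/-- The element `xy + yx` is odd, being a sum of products of an even and an odd element, yet it is a
scalar and therefore even. -/
theorem polar_eq_zero [FiniteDimensional ℝ V] {x y : V} (hx : x ∈ G.vectors 0)
    (hy : y ∈ G.vectors 1) : QuadraticMap.polar Q x y = 0 := by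
  have h : algebraMap ℝ (CliffordAlgebra Q) (QuadraticMap.polar Q x y) ∈ G.part 1 := by
    rw [← CliffordAlgebra.ι_mul_ι_add_swap]
    exact (G.part 1).add_mem (by simpa using G.mul_mem 0 1 _ _ hx hy)
      (by simpa using G.mul_mem 1 0 _ _ hy hx)
  have h' : algebraMap ℝ (CliffordAlgebra Q) (QuadraticMap.polar Q x y) ∈ G.part 0 :=
    G.evenSubalgebra.algebraMap_mem _
  exact (FaithfulSMul.algebraMap_eq_zero_iff ℝ (CliffordAlgebra Q)).1
    (Submodule.disjoint_def.1 G.isCompl.disjoint _ h' h)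

theorem isCompl_vectors (hQ : (QuadraticMap.associated Q).Nondegenerate)
    (hG : G.PreservesMultivectors) : IsCompl (G.vectors 0) (G.vectors 1) := by
  constructor
  · refine Submodule.disjoint_def.2 fun x h₀ h₁ => polar_separating hQ x fun y => ?_
    have hx : CliffordAlgebra.ι Q x = 0 := Submodule.disjoint_def.1 G.isCompl.disjoint _ h₀ h₁
    refine (FaithfulSMul.algebraMap_eq_zero_iff ℝ (CliffordAlgebra Q)).1 ?_
    rw [← CliffordAlgebra.ι_mul_ι_add_swap, hx, zero_mul, mul_zero, add_zero]
  · refine codisjoint_iff.2 (eq_top_iff.2 fun x _ => ?_)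
    obtain ⟨x₀, hx₀⟩ := (hG x).1
    refine Submodule.mem_sup.2 ⟨x₀, ?_, x - x₀, ?_, add_sub_cancel _ _⟩
    · change CliffordAlgebra.ι Q x₀ ∈ G.part 0
      rw [hx₀]
      exact Submodule.projection_apply_mem G.isCompl _
    · change CliffordAlgebra.ι Q (x - x₀) ∈ G.part 1
      rw [map_sub, hx₀]
      exact Submodule.sub_projection_mem G.isCompl _

/-- A vector of one parity orthogonal to all vectors of that parity is orthogonal to all of `V`, so
the form stays nondegenerate on each parity and orthonormal bases of the two parts can be joined. -/
theorem exists_adaptedBasis [FiniteDimensional ℝ V]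
    (hQ : (QuadraticMap.associated Q).Nondegenerate) (hG : G.PreservesMultivectors) :
    ∃ b : Module.Basis (Fin (Module.finrank ℝ V)) ℝ V, G.IsAdaptedBasis b := by
  have hc := isCompl_vectors hQ hG
  have hsup : ∀ y, ∃ y₀ ∈ G.vectors 0, ∃ y₁ ∈ G.vectors 1, y₀ + y₁ = y := fun y =>
    Submodule.mem_sup.1 (hc.sup_eq_top ▸ Submodule.mem_top)
  obtain ⟨b₀, h₀, o₀⟩ := exists_orthonormal_basis_submodule (Q := Q) (G.vectors 0) fun x hx h =>
    polar_separating hQ x fun y => by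
      obtain ⟨y₀, hy₀, y₁, hy₁, rfl⟩ := hsup y
      rw [QuadraticMap.polar_add_right, h y₀ hy₀, polar_eq_zero hx hy₁, add_zero]
  obtain ⟨b₁, h₁, o₁⟩ := exists_orthonormal_basis_submodule (Q := Q) (G.vectors 1) fun x hx h =>
    polar_separating hQ x fun y => by
      obtain ⟨y₀, hy₀, y₁, hy₁, rfl⟩ := hsup y
      rw [QuadraticMap.polar_add_right, h y₁ hy₁, QuadraticMap.polar_comm, polar_eq_zero hy₀ hx,
        add_zero]
  let c := (b₀.prod b₁).map (Submodule.prodEquivOfIsCompl _ _ hc)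
  have hcl : ∀ i, c (Sum.inl i) = b₀ i := fun i => by simp [c]
  have hcr : ∀ i, c (Sum.inr i) = b₁ i := fun i => by simp [c]
  have hn : ∀ i, Q (c i) = 1 ∨ Q (c i) = -1 := by
    rintro (i | i)
    · rw [hcl]; exact h₀ i
    · rw [hcr]; exact h₁ i
  have ho : ∀ i j, i ≠ j → QuadraticMap.polar Q (c i) (c j) = 0 := by
    rintro (i | i) (j | j) hij
    · rw [hcl, hcl]; exact o₀ i j fun h => hij (by rw [h])
    · rw [hcl, hcr]; exact polar_eq_zero (b₀ i).2 (b₁ j).2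
    · rw [hcl, hcr, QuadraticMap.polar_comm]; exact polar_eq_zero (b₀ j).2 (b₁ i).2
    · rw [hcr, hcr]; exact o₁ i j fun h => hij (by rw [h])
  have hh : ∀ i, CliffordAlgebra.ι Q (c i) ∈ G.part 0 ∨ CliffordAlgebra.ι Q (c i) ∈ G.part 1 := by
    rintro (i | i)
    · rw [hcl]; exact .inl (b₀ i).2
    · rw [hcr]; exact .inr (b₁ i).2
  let σ := Fintype.equivFinOfCardEq (Module.finrank_eq_card_basis c).symm
  refine ⟨c.reindex σ, ⟨fun i => ?_, fun i j hij => ?_, fun i => ?_⟩⟩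
  · rw [Module.Basis.reindex_apply]; exact hn _
  · rw [Module.Basis.reindex_apply, Module.Basis.reindex_apply]
    exact ho _ _ (σ.symm.injective.ne hij)
  · rw [Module.Basis.reindex_apply]; exact hh _

end Z2Grading

end AdaptedBasis

/-! ### Signature and sign counts -/

section Signature

variable {ι : Type*} [Fintype ι] (s : ι → ℤˣ)

theorem sum_units_eq_ncard_sub_ncard (P : ι → Prop) [DecidablePred P] :
    ∑ i with P i, (s i : ℤ) =
      ({i | P i ∧ s i = 1} : Set ι).ncard - ({i | P i ∧ s i = -1} : Set ι).ncard := by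
  classical
  have h : ∀ i, (s i : ℤ) = (if s i = 1 then 1 else 0) - if s i = -1 then 1 else 0 := fun i => by
    rcases Int.units_eq_one_or (s i) with h | h <;> rw [h] <;> decide
  simp only [Set.ncard_eq_toFinset_card', Set.toFinset_ofPred]
  rw [Finset.sum_congr rfl fun i _ => h i, Finset.sum_sub_distrib, Finset.sum_boole,
    Finset.sum_boole, Finset.filter_filter, Finset.filter_filter]

variable {V : Type*} [AddCommGroup V] [Module ℝ V] {Q : QuadraticForm ℝ V}

theorem sigPos_sigNeg_of_basis (s : Fin (Module.finrank ℝ V) → ℤˣ)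
    (b : Module.Basis (Fin (Module.finrank ℝ V)) ℝ V)
    (hs : ∀ i, Q (b i) = ((s i : ℤ) : ℝ))
    (ho : ∀ i j, i ≠ j → QuadraticMap.polar Q (b i) (b j) = 0) :
    sigPos Q = ({i | s i = 1} : Set _).ncard ∧ sigNeg Q = ({i | s i = -1} : Set _).ncard := by
  have hort : LinearMap.IsOrthoᵢ (QuadraticMap.associated Q) b := fun i j hij => by
    change QuadraticMap.associated Q (b i) (b j) = 0
    have h := ho i j hij
    rw [QuadraticMap.polar] at h
    rw [QuadraticMap.associated_apply, h, smul_zero]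
  have e := Q.isometryEquivWeightedSumSquares b hort
  rw [QuadraticForm.sigPos_of_equiv_weightedSumSquares ⟨e⟩,
    QuadraticForm.sigNeg_of_equiv_weightedSumSquares ⟨e⟩]
  constructor <;> congr 1 <;> ext i <;> simp only [Set.mem_ofPred_eq, hs] <;>
    rcases Int.units_eq_one_or (s i) with h | h <;> rw [h] <;> norm_num

end Signature

/-! ### The even part for an adapted basis -/

section Main

variable {V : Type*} [AddCommGroup V] [Module ℝ V] {Q : QuadraticForm ℝ V}

/-- If all generators were even, the even part would be the whole algebra and the odd part zero. -/
theorem IsCliffordSystem.exists_odd {ι A : Type*} [Fintype ι] [Ring A] [Algebra ℝ A]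
    {s : ι → ℤˣ} {e : ι → A} (h : IsCliffordSystem s e) (G : Z2Grading A) (hG : G.IsNontrivial) :
    ∃ i, e i ∉ G.part 0 := by
  by_contra! hall
  refine hG (eq_bot_iff.2 fun x hx => ?_)
  have htop : (⊤ : Subalgebra ℝ A) ≤ G.evenSubalgebra := by
    rw [← h.adjoin_eq_top, Algebra.adjoin_le_iff]
    rintro _ ⟨i, rfl⟩
    exact hall i
  exact Submodule.disjoint_def.1 G.isCompl.disjoint x (htop (x := x) trivial) hx

theorem Z2Grading.IsAdaptedBasis.isMatrixOverFactor [FiniteDimensional ℝ V]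
    {G : Z2Grading (CliffordAlgebra Q)} (hG : G.IsNontrivial)
    {b : Module.Basis (Fin (Module.finrank ℝ V)) ℝ V} (hb : G.IsAdaptedBasis b) :
    IsMatrixOverFactor G.evenSubalgebra
      (factorOf ((G.evenCount b 1 : ℤ) - G.evenCount b (-1)) ((sigPos Q : ℤ) - sigNeg Q)) ∧
    Module.finrank ℝ G.evenSubalgebra = 2 ^ (sigPos Q + sigNeg Q - 1) := by
  classical
  obtain ⟨s, hs⟩ := exists_units_eq hb.norm
  have hsys := isCliffordSystem_basis b hs hb.orthogonal
  obtain ⟨o, ho⟩ := hsys.exists_odd G hG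
  obtain ⟨hp, hq⟩ := sigPos_sigNeg_of_basis s b hs hb.orthogonal
  have h1 : ∀ i, CliffordAlgebra.ι Q (b i) ∉ G.part 0 → CliffordAlgebra.ι Q (b i) ∈ G.part 1 :=
    fun i hi => (hb.homogeneous i).resolve_left hi
  have hpos : ∀ i, Q (b i) = 1 ↔ s i = 1 := fun i => by
    rw [hs]; rcases Int.units_eq_one_or (s i) with h | h <;> rw [h] <;> norm_num
  have hneg : ∀ i, Q (b i) = -1 ↔ s i = -1 := fun i => by
    rw [hs]; rcases Int.units_eq_one_or (s i) with h | h <;> rw [h] <;> norm_num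
  have hrow := sum_units_eq_ncard_sub_ncard s fun i => CliffordAlgebra.ι Q (b i) ∈ G.part 0
  have hcol := sum_units_eq_ncard_sub_ncard s fun _ => True
  simp only [true_and, Finset.filter_true] at hcol
  constructor
  · have h := hsys.isMatrixOverFactor_even G (fun i => CliffordAlgebra.ι Q (b i) ∈ G.part 0)
      (fun _ => id) h1 o ho
    rw [hrow, hcol, ← hp, ← hq] at h
    simpa only [Z2Grading.evenCount, hpos, hneg] using h
  · rw [hsys.finrank_even G (fun i => CliffordAlgebra.ι Q (b i) ∈ G.part 0) (fun _ => id) h1 o ho,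
      hp, hq, ← Set.ncard_union_eq]
    · rw [show {i | s i = 1} ∪ {i | s i = -1} = Set.univ from
        Set.eq_univ_of_forall fun i => Int.units_eq_one_or (s i), Set.ncard_univ,
        Nat.card_eq_fintype_card]
    · refine Set.disjoint_left.2 fun i hi hi' => ?_
      rw [Set.mem_ofPred_eq] at hi hi'
      rw [hi] at hi'
      exact absurd hi' (by decide)

end Main

/-! ### Gradings by sign reflections -/

section Example

/-- The grading of an algebra by the eigenspaces of an involution. -/
def Z2Grading.ofInvolution {A : Type*} [Ring A] [Algebra ℝ A] (α : A →ₐ[ℝ] A)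
    (hα : ∀ x, α (α x) = x) : Z2Grading A where
  part i := LinearMap.ker (α.toLinearMap - (if i = 0 then (1 : ℝ) else -1) • LinearMap.id)
  isCompl := by
    constructor
    · refine Submodule.disjoint_def.2 fun x h₀ h₁ => ?_
      simp [sub_eq_zero] at h₀ h₁
      rw [h₀, ← two_smul ℝ x] at h₁
      simpa using h₁
    · refine codisjoint_iff.2 (eq_top_iff.2 fun x _ => Submodule.mem_sup.2
        ⟨(2⁻¹ : ℝ) • (x + α x), ?_, (2⁻¹ : ℝ) • (x - α x), ?_, ?_⟩)
      · simp [hα, add_comm]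
      · simp [hα]
      · rw [← smul_add, add_add_sub_cancel, ← two_smul ℝ x, smul_smul]
        norm_num
  mul_mem i j a b ha hb := by
    simp only [LinearMap.mem_ker, LinearMap.sub_apply, LinearMap.smul_apply, LinearMap.id_apply,
      AlgHom.toLinearMap_apply, sub_eq_zero] at ha hb ⊢
    rw [map_mul, ha, hb, smul_mul_smul_comm]
    congr 1
    have h2 : ∀ k : ZMod 2, k = 0 ∨ k = 1 := by decide
    rcases h2 i with rfl | rfl <;> rcases h2 j with rfl | rfl <;>
      simp [show (1 : ZMod 2) + 1 = 0 by decide]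

theorem Z2Grading.mem_ofInvolution_zero {A : Type*} [Ring A] [Algebra ℝ A] {α : A →ₐ[ℝ] A}
    {hα : ∀ x, α (α x) = x} {x : A} : x ∈ (Z2Grading.ofInvolution α hα).part 0 ↔ α x = x := by
  simp [Z2Grading.ofInvolution, sub_eq_zero]

theorem Z2Grading.mem_ofInvolution_one {A : Type*} [Ring A] [Algebra ℝ A] {α : A →ₐ[ℝ] A}
    {hα : ∀ x, α (α x) = x} {x : A} : x ∈ (Z2Grading.ofInvolution α hα).part 1 ↔ α x = -x := by
  simp [Z2Grading.ofInvolution, eq_neg_iff_add_eq_zero]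

variable {ι : Type*} [Fintype ι]

/-- The isometry of `∑ ± xᵢ²` which changes the signs of some coordinates. -/
noncomputable def signReflection (s ε : ι → ℤˣ) : signForm s →qᵢ signForm s where
  toLinearMap := LinearMap.mulLeft ℝ fun i => ((ε i : ℤ) : ℝ)
  map_app' x := by
    have hε : ∀ i, ((ε i : ℤ) : ℝ) * ((ε i : ℤ) : ℝ) = 1 := fun i => by
      rw [← Int.cast_mul, ← Units.val_mul, Int.units_mul_self]; simp
    simp only [signForm, QuadraticMap.weightedSumSquares_apply]
    refine Finset.sum_congr rfl fun i _ => ?_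
    change _ • (((ε i : ℤ) : ℝ) * x i * (((ε i : ℤ) : ℝ) * x i)) = _
    rw [mul_mul_mul_comm, hε, one_mul]

theorem signReflection_signReflection (s ε : ι → ℤˣ) (x : ι → ℝ) :
    signReflection s ε (signReflection s ε x) = x := by
  ext i
  change ((ε i : ℤ) : ℝ) * (((ε i : ℤ) : ℝ) * x i) = x i
  rw [← mul_assoc, ← Int.cast_mul, ← Units.val_mul, Int.units_mul_self]
  simp

/-- The grading of the Clifford algebra of `∑ ± xᵢ²` in which the `i`-th basis vector has the
parity given by the sign `ε i`. -/
noncomputable def signGrading (s ε : ι → ℤˣ) : Z2Grading (CliffordAlgebra (signForm s)) :=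
  .ofInvolution (CliffordAlgebra.map (signReflection s ε)) fun x => by
    rw [← AlgHom.comp_apply, CliffordAlgebra.map_comp_map,
      show (signReflection s ε).comp (signReflection s ε) = .id _ from
        DFunLike.ext _ _ (signReflection_signReflection s ε), CliffordAlgebra.map_id]
    rfl

variable (s ε : ι → ℤˣ)

theorem ι_mem_signGrading_zero {x : ι → ℝ} (hx : signReflection s ε x = x) :
    CliffordAlgebra.ι (signForm s) x ∈ (signGrading s ε).part 0 := by
  rw [signGrading, Z2Grading.mem_ofInvolution_zero, CliffordAlgebra.map_apply_ι, hx]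

theorem ι_mem_signGrading_one {x : ι → ℝ} (hx : signReflection s ε x = -x) :
    CliffordAlgebra.ι (signForm s) x ∈ (signGrading s ε).part 1 := by
  rw [signGrading, Z2Grading.mem_ofInvolution_one, CliffordAlgebra.map_apply_ι, hx, map_neg]

theorem signReflection_basis [DecidableEq ι] (i : ι) :
    signReflection s ε (Pi.basisFun ℝ ι i) = ((ε i : ℤ) : ℝ) • Pi.basisFun ℝ ι i := by
  ext j
  change ((ε j : ℤ) : ℝ) * _ = _ * _
  rcases eq_or_ne i j with rfl | hij
  · rfl
  · simp [hij.symm]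

theorem signGrading_preservesMultivectors : (signGrading s ε).PreservesMultivectors := by
  intro x
  have hinv := signReflection_signReflection s ε x
  set y := signReflection s ε x with hy
  -- The projections of `x` are its averages `(x ± y) / 2` with its reflection, which are again
  -- vectors.
  have h₀ : CliffordAlgebra.ι (signForm s) ((2⁻¹ : ℝ) • (x + y)) ∈ (signGrading s ε).part 0 :=
    ι_mem_signGrading_zero s ε (by rw [map_smul, map_add, hinv, ← hy, add_comm])
  have h₁ : CliffordAlgebra.ι (signForm s) ((2⁻¹ : ℝ) • (x - y)) ∈ (signGrading s ε).part 1 :=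
    ι_mem_signGrading_one s ε (by rw [map_smul, map_sub, hinv, ← hy, ← smul_neg, neg_sub])
  have hxy : x = (2⁻¹ : ℝ) • (x + y) + (2⁻¹ : ℝ) • (x - y) := by
    rw [← smul_add, add_add_sub_cancel, ← two_smul ℝ x, smul_smul]
    norm_num
  have hι := (congrArg (CliffordAlgebra.ι (signForm s)) hxy).trans (map_add _ _ _)
  refine ⟨⟨(2⁻¹ : ℝ) • (x + y), ?_⟩, ⟨(2⁻¹ : ℝ) • (x - y), ?_⟩⟩
  · rw [hι, Z2Grading.proj₀, map_add, Submodule.projection_apply_of_mem_left _ h₀,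
      (Submodule.projection_apply_eq_zero_iff _).2 h₁, add_zero]
  · rw [hι, Z2Grading.proj₁, map_add, Submodule.projection_apply_of_mem_left _ h₁,
      (Submodule.projection_apply_eq_zero_iff _).2 h₀, zero_add]

theorem nondegenerate_signForm : (QuadraticMap.associated (signForm s)).Nondegenerate := by
  rw [QuadraticMap.nondegenerate_associated_iff, QuadraticMap.nondegenerate_iff_radical_eq_bot,
    signForm, QuadraticForm.radical_weightedSumSquares]
  refine eq_bot_iff.2 fun x hx => ?_
  rw [Pi.mem_spanSubset_iff] at hx
  exact funext fun i => hx i (by simp)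

theorem signGrading_isNontrivial {i : ι} (hi : ε i = -1) : (signGrading s ε).IsNontrivial := by
  classical
  intro h
  have h₁ : CliffordAlgebra.ι (signForm s) (Pi.basisFun ℝ ι i) ∈ (signGrading s ε).part 1 :=
    ι_mem_signGrading_one s ε (by rw [signReflection_basis, hi]; simp)
  rw [h, Submodule.mem_bot] at h₁
  have h₂ := CliffordAlgebra.ι_sq_scalar (signForm s) (Pi.basisFun ℝ ι i)
  rw [h₁, mul_zero, signForm_basis, eq_comm, FaithfulSMul.algebraMap_eq_zero_iff] at h₂
  simp at h₂

theorem signGrading_isMatrixOverFactor {i : ι} (hi : ε i = -1) :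
    IsMatrixOverFactor (signGrading s ε).evenSubalgebra
      (factorOf (∑ i with ε i = 1, (s i : ℤ)) (∑ i, (s i : ℤ))) ∧
    Module.finrank ℝ (signGrading s ε).evenSubalgebra = 2 ^ (Fintype.card ι - 1) := by
  classical
  have h0 : ∀ i, ε i = 1 → CliffordAlgebra.ι (signForm s) (Pi.basisFun ℝ ι i) ∈
      (signGrading s ε).part 0 := fun i hi =>
    ι_mem_signGrading_zero s ε (by rw [signReflection_basis, hi]; simp)
  have h1 : ∀ i, ¬ε i = 1 → CliffordAlgebra.ι (signForm s) (Pi.basisFun ℝ ι i) ∈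
      (signGrading s ε).part 1 := fun i hi =>
    ι_mem_signGrading_one s ε (by
      rw [signReflection_basis, (Int.units_eq_one_or _).resolve_left hi]; simp)
  have ho : ¬ε i = 1 := by rw [hi]; decide
  exact ⟨(isCliffordSystem_signForm s).isMatrixOverFactor_even _ _ h0 h1 i ho,
    (isCliffordSystem_signForm s).finrank_even _ _ h0 h1 i ho⟩

end Example

theorem mainTheorem4 :
    (∀ (V : Type u) [AddCommGroup V] [Module ℝ V] [FiniteDimensional ℝ V]
      (Q : QuadraticForm ℝ V) (G : Z2Grading (CliffordAlgebra Q)),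
      (QuadraticMap.associated Q).Nondegenerate → G.PreservesMultivectors → G.IsNontrivial →
      (∃ b : Module.Basis (Fin (Module.finrank ℝ V)) ℝ V, G.IsAdaptedBasis b) ∧
      ∀ (p q p₀ q₀ : ℕ) (b : Module.Basis (Fin (Module.finrank ℝ V)) ℝ V),
        p = sigPos Q → q = sigNeg Q →
        G.IsAdaptedBasis b → p₀ = G.evenCount b 1 → q₀ = G.evenCount b (-1) →
        HasFactor (2 ^ (p + q - 1)) G.evenSubalgebra (factorOf ((p₀ : ℤ) - q₀) ((p : ℤ) - q)) ∧
        ((p : ℤ) - q ≡ 1 [ZMOD 4] → (p₀ : ℤ) - q₀ ≡ 1 [ZMOD 4] →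
          NotClifford.{w} G.evenSubalgebra)) ∧
    (∃ (Q : QuadraticForm ℝ (Fin 3 → ℝ)) (G : Z2Grading (CliffordAlgebra Q)),
      (QuadraticMap.associated Q).Nondegenerate ∧ G.PreservesMultivectors ∧ G.IsNontrivial ∧
      HasFactor (2 ^ (3 - 1)) G.evenSubalgebra Factor.RRRR ∧
      NotClifford.{w} G.evenSubalgebra) := by
  refine ⟨fun V _ _ _ Q G hQ hG hG' => ⟨Z2Grading.exists_adaptedBasis hQ hG, ?_⟩, ?_⟩
  · rintro p q p₀ q₀ b rfl rfl hb rfl rfl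
    obtain ⟨hf, hd⟩ := hb.isMatrixOverFactor hG'
    refine ⟨hd ▸ hf.hasFactor, fun hc hr => notClifford_of_finrank_center ?_⟩
    rw [hf.finrank_center_eq, centerDim_factorOf hc hr]
    decide
  -- Signature `(2, 1)` with a single even basis vector, of square `+1`: then `p - q = 1` and `p₀ -
  -- q₀ = 1`, the entry `4ℝ` of the table.
  · have hε : (![1, -1, -1] : Fin 3 → ℤˣ) 1 = -1 := rfl
    obtain ⟨hf, hd⟩ := signGrading_isMatrixOverFactor ![1, 1, -1] ![1, -1, -1] hε
    rw [show ∑ i with (![1, -1, -1] : Fin 3 → ℤˣ) i = 1, ((![1, 1, -1] : Fin 3 → ℤˣ) i : ℤ) = 1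
        by decide, show ∑ i, ((![1, 1, -1] : Fin 3 → ℤˣ) i : ℤ) = 1 by decide] at hf
    refine ⟨_, signGrading ![1, 1, -1] ![1, -1, -1], nondegenerate_signForm _,
      signGrading_preservesMultivectors _ _,
      signGrading_isNontrivial _ _ hε, ?_, notClifford_of_finrank_center ?_⟩
    · have h := hf.hasFactor
      rw [hd] at h
      exact h
    · rw [hf.finrank_center_eq]
      decide
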